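/- Let $X$ be a standard Borel space, let $PX$ be the (standard Borel) space of probability measures on $X$, with the $\sigma$-algebra generated by the evaluations $q\mapsto q(A)$, and let $S_\infty$ be the group of permutations of $\mathbb{N}$ moving only finitely many elements, acting on $X^{\mathbb{N}}$ by $\sigma\cdot(x_i)_i=(x_{\sigma^{-1}(i)})_i$. Let $\mathbf{PS(Borel)}$ be the category whose objects are standard Borel probability spaces $(Y,q)$ and whose morphisms $(Y,q)\to(Z,s)$ are the Markov kernels $f:Y\to Z$ with $\int_Y f(B|y)\,q(dy)=s(B)$ for all measurable $B\subseteq Z$, where $f$ and $g$ are identified if they are $q$-almost surely equal, i.e. $\int_A f(B|y)\,q(dy)=\int_A g(B|y)\,q(dy)$ for all measurable $A\subseteq Y$, $B\subseteq Z$. A morphism $f:(Y,q)\to(Z,s)$ is almost surely deterministic if the kernels $y\mapsto f(\cdot|y)\otimes f(\cdot|y)$ and $y\mapsto (z\mapsto(z,z))_*f(\cdot|y)$ from $Y$ to $Z\times Z$ are $q$-almost surely equal. Let $\mathrm{copy}_{\mathbb{N}}:PX\to(PX)^{\mathbb{N}}$ be the deterministic kernel $q\mapsto(q,q,\dots)$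 and $\mathrm{samp}^{\mathbb{N}}:(PX)^{\mathbb{N}}\to X^{\mathbb{N}}$ the kernel $(q_n)_n\mapsto\bigotimes_n q_n$, so that $(\mathrm{samp}^{\mathbb{N}}\circ\mathrm{copy}_{\mathbb{N}})(\,\cdot\,|q)=q^{\otimes\mathbb{N}}$. Let $p$ be an exchangeable probability measure on $X^{\mathbb{N}}$, i.e. one invariant under the action of $S_\infty$, and let $D'$ be the induced dynamical system in $\mathbf{PS(Borel)}$, that is, the functor from the one-object category $S_\infty$ to $\mathbf{PS(Borel)}$ with value $(X^{\mathbb{N}},p)$ that sends a permutation to the corresponding deterministic kernel. Then: 1. There is a unique probability measure $\mu$ on $PX$ such that $\mathrm{samp}^{\mathbb{N}}\circ\mathrm{copy}_{\mathbb{N}}\circ\mu=p$. 2. For this $\mu$, the object $(PX,\mu)$ with the cone $$(PX,\mu)\xrightarrow{\ \mathrm{copy}_{\mathbb{N}}\ }\big((PX)^{\mathbb{N}},\mathrm{copy}_{\mathbb{N}}\circ\mu\big)\xrightarrow{\ \mathrm{samp}^{\mathbb{N}}\ }(X^{\mathbb{N}},p)$$ is a limit of $D'$ in $\mathbf{PS(Borel)}$.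 3. $(PX,\mu)$ is also an invariant object of $D'$ in $\mathbf{PS(Borel)}$: there is a morphism $r:(X^{\mathbb{N}},p)\to(PX,\mu)$ which is a colimiting cocone of $D'$ and is such that, whenever $f:(X^{\mathbb{N}},p)\to(Y,q)$ satisfies $f\circ\sigma=f$ in $\mathbf{PS(Borel)}$ for all $\sigma\in S_\infty$ and $\tilde f:(PX,\mu)\to(Y,q)$ is the unique morphism with $\tilde f\circ r=f$, the morphism $f$ is almost surely deterministic if and only if $\tilde f$ is. Moreover, $r$ can be chosen such that $\ell=\mathrm{samp}^{\mathbb{N}}\circ\mathrm{copy}_{\mathbb{N}}$ and $r$ are Bayesian inverses of each other, i.e. $\int_B \ell(A|q)\,\mu(dq)=\int_A r(B|x)\,p(dx)$ for all measurable $A\subseteq X^{\mathbb{N}}$ and $B\subseteq PX$. -/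

import Mathlib

open MeasureTheory ProbabilityTheory CategoryTheory CategoryTheory.Limits

universe u w

namespace ASDeFinetti

noncomputable section

/-! ### The space of probability measures on a standard Borel space is standard Borel -/

/-- A measurable retract of a standard Borel space is standard Borel. -/
theorem standardBorel_of_retract {α β : Type*} [MeasurableSpace α] [MeasurableSpace β]
    [StandardBorelSpace β] {F : α → β} {G : β → α} (hF : Measurable F) (hG : Measurable G)
    (h : Function.LeftInverse G F) : StandardBorelSpace α := by
  have hr : Set.range F = {b | F (G b) = b} := by
    ext b
    constructor
    · rintro ⟨a, rfl⟩
      exact congrArg F (h a)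
    · intro hb
      exact ⟨G b, hb⟩
  have hm : MeasurableSet (Set.range F) := by
    rw [hr]
    exact measurableSet_eq_fun (hF.comp hG) measurable_id
  have he : MeasurableEmbedding F := .of_measurable_inverse hF hm hG h
  have hS : StandardBorelSpace (Set.range F) := hm.standardBorel
  let e : α ≃ᵐ Set.range F := he.equivRange
  obtain ⟨τ, hb, hp⟩ := hS.polish
  let τ' : TopologicalSpace α := τ.induced e
  have hh : Topology.IsClosedEmbedding e :=
    (e.toEquiv.toHomeomorphOfIsInducing ⟨rfl⟩).isClosedEmbedding
  have hb' : BorelSpace α := ⟨by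
    have h1 := congrArg (MeasurableSpace.comap e) hb.measurable_eq
    exact e.measurableEmbedding.comap_eq.symm.trans (h1.trans borel_comap.symm)⟩
  exact ⟨⟨τ', hb', hh.polishSpace⟩⟩

/-- The restriction to the rationals of the distribution function. -/
def ratCDF (μ : ProbabilityMeasure ℝ) (q : ℚ) : ℝ := cdf (μ : Measure ℝ) q

theorem measurable_ratCDF : Measurable ratCDF := by
  refine measurable_pi_lambda _ fun q => ?_
  have : (fun μ : ProbabilityMeasure ℝ => ratCDF μ q)
      = fun μ : ProbabilityMeasure ℝ => ((μ : Measure ℝ) (Set.Iic (q : ℝ))).toReal := by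
    funext μ
    exact cdf_eq_real _ _
  rw [this]
  exact ((Measure.measurable_coe measurableSet_Iic).comp measurable_subtype_coe).ennreal_toReal

/-- The probability measure with a given rational distribution function
(some probability measure if the function is not a rational distribution function). -/
def ofRatCDF (f : ℚ → ℝ) : ProbabilityMeasure ℝ :=
  ⟨(stieltjesOfMeasurableRat (fun f : ℚ → ℝ => f) measurable_id f).measure, inferInstance⟩

theorem measurable_ofRatCDF : Measurable ofRatCDF :=
  (measurable_measure_stieltjesOfMeasurableRat _).subtype_mk

theorem ofRatCDF_ratCDF (μ : ProbabilityMeasure ℝ) : ofRatCDF (ratCDF μ) = μ := by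
  have hpt : IsRatStieltjesPoint (fun f : ℚ → ℝ => f) (ratCDF μ) :=
    { mono := fun a b hab => monotone_cdf _ (by exact_mod_cast hab)
      tendsto_atTop_one :=
        (tendsto_cdf_atTop _).comp (tendsto_ratCast_atTop_iff.2 Filter.tendsto_id)
      tendsto_atBot_zero :=
        (tendsto_cdf_atBot _).comp (tendsto_ratCast_atBot_iff.2 Filter.tendsto_id)
      iInf_rat_gt_eq := fun t => by
        have h := (cdf (μ : Measure ℝ)).iInf_rat_gt_eq (t : ℝ)
        have hs : Function.Surjective
            (fun r : Set.Ioi t => (⟨r.1, by exact_mod_cast r.2⟩ : {r' : ℚ // (t : ℝ) < r'})) := by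
          rintro ⟨r, hr⟩
          exact ⟨⟨r, by exact_mod_cast hr⟩, rfl⟩
        exact (hs.iInf_comp
          (fun r : {r' : ℚ // (t : ℝ) < r'} => cdf (μ : Measure ℝ) (r : ℚ))).trans h }
  apply Subtype.ext
  change (stieltjesOfMeasurableRat (fun f : ℚ → ℝ => f) measurable_id (ratCDF μ)).measure
    = (μ : Measure ℝ)
  refine ext_of_generate_finite _
    ((BorelSpace.measurable_eq (α := ℝ)).trans Real.borel_eq_generateFrom_Iic_rat)
    Real.isPiSystem_Iic_rat (fun s hs => ?_) (by simp)
  obtain ⟨q, rfl⟩ := by simpa using hs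
  rw [measure_stieltjesOfMeasurableRat_Iic, stieltjesOfMeasurableRat_eq,
    toRatCDF_of_isRatStieltjesPoint hpt]
  exact ofReal_cdf _ _

instance : StandardBorelSpace (ProbabilityMeasure ℝ) :=
  standardBorel_of_retract measurable_ratCDF measurable_ofRatCDF ofRatCDF_ratCDF

/-- Push-forward of probability measures along a measurable map. -/
def pushforward {α β : Type*} [MeasurableSpace α] [MeasurableSpace β] (f : α → β)
    (hf : Measurable f) (μ : ProbabilityMeasure α) : ProbabilityMeasure β :=
  ⟨(μ : Measure α).map f, Measure.isProbabilityMeasure_map hf.aemeasurable⟩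

theorem measurable_pushforward {α β : Type*} [MeasurableSpace α] [MeasurableSpace β] (f : α → β)
    (hf : Measurable f) : Measurable (pushforward f hf) :=
  ((Measure.measurable_map f hf).comp measurable_subtype_coe).subtype_mk

instance instStandardBorelProbabilityMeasure (X : Type*) [MeasurableSpace X]
    [StandardBorelSpace X] : StandardBorelSpace (ProbabilityMeasure X) := by
  rcases isEmpty_or_nonempty X with hX | hX
  · have : IsEmpty (ProbabilityMeasure X) :=
      ⟨fun μ => hX.elim (nonempty_of_isProbabilityMeasure (μ : Measure X)).some⟩
    have : DiscreteMeasurableSpace (ProbabilityMeasure X) :=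
      ⟨fun s => by rw [Set.eq_empty_of_isEmpty s]; exact MeasurableSet.empty⟩
    infer_instance
  · have he := measurableEmbedding_embeddingReal X
    obtain ⟨g, hg, hge⟩ := he.exists_measurable_extend (g := (id : X → X)) measurable_id
      (fun _ => hX)
    refine standardBorel_of_retract (measurable_pushforward _ he.measurable)
      (measurable_pushforward g hg) fun μ => Subtype.ext ?_
    change ((μ : Measure X).map (embeddingReal X)).map g = (μ : Measure X)
    rw [Measure.map_map hg he.measurable, hge, Measure.map_id]

/-! ### The category of standard Borel probability spaces -/

/-- Almost sure equality of kernels: `∫_A f(B|x) p(dx) = ∫_A g(B|x) p(dx)` for all measurable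
`A` and `B`. -/
def ASEq {X Y : Type*} [MeasurableSpace X] [MeasurableSpace Y] (p : Measure X)
    (f g : Kernel X Y) : Prop :=
  ∀ ⦃A : Set X⦄ ⦃B : Set Y⦄, MeasurableSet A → MeasurableSet B →
    ∫⁻ x in A, f x B ∂p = ∫⁻ x in A, g x B ∂p

theorem asEq_iff_ae {X Y : Type*} [MeasurableSpace X] [MeasurableSpace Y] [StandardBorelSpace Y]
    {p : Measure X} [IsFiniteMeasure p] {f g : Kernel X Y} [IsMarkovKernel f]
    [IsMarkovKernel g] : ASEq p f g ↔ f =ᵐ[p] g := by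
  constructor
  · intro h
    refine Kernel.ae_eq_of_compProd_eq ?_
    refine ext_of_generate_finite _ generateFrom_prod.symm isPiSystem_prod ?_ (by simp)
    rintro _ ⟨A, hA, B, hB, rfl⟩
    rw [Measure.compProd_apply_prod hA hB, Measure.compProd_apply_prod hA hB]
    exact h hA hB
  · intro h A B _ _
    exact lintegral_congr_ae (ae_restrict_of_ae (h.mono fun x hx => by simp only [hx]))

/-- A standard Borel probability space: an object of `PS(Borel)`. -/
structure PSBorel : Type (u + 1) where
  /-- The underlying set. -/
  carrier : Type u
  [measurableSpace : MeasurableSpace carrier]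
  [standardBorel : StandardBorelSpace carrier]
  /-- The probability measure. -/
  law : ProbabilityMeasure carrier

namespace PSBorel

attribute [instance] PSBorel.measurableSpace PSBorel.standardBorel

/-- The object `(X, p)`. -/
abbrev of (X : Type u) [MeasurableSpace X] [StandardBorelSpace X] (p : ProbabilityMeasure X) :
    PSBorel.{u} := ⟨X, p⟩

/-- A measure-preserving Markov kernel. -/
structure MPKernel (x y : PSBorel.{u}) where
  /-- The underlying kernel. -/
  ker : Kernel x.carrier y.carrier
  [markov : IsMarkovKernel ker]
  preserves : ker ∘ₘ (x.law : Measure x.carrier) = y.law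

attribute [instance] MPKernel.markov

/-- Almost sure equality of measure-preserving Markov kernels. -/
instance setoid (x y : PSBorel.{u}) : Setoid (MPKernel x y) where
  r f g := ASEq (x.law : Measure x.carrier) f.ker g.ker
  iseqv := ⟨fun _ _ _ _ _ => rfl, fun h _ _ hA hB => (h hA hB).symm,
    fun h h' _ _ hA hB => (h hA hB).trans (h' hA hB)⟩

theorem equiv_iff_ae {x y : PSBorel.{u}} {f g : MPKernel x y} :
    f ≈ g ↔ f.ker =ᵐ[(x.law : Measure x.carrier)] g.ker := asEq_iff_ae

/-- The identity kernel. -/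
def MPKernel.id (x : PSBorel.{u}) : MPKernel x x where
  ker := Kernel.id
  preserves := Measure.id_comp

/-- Composition of kernels (Chapman-Kolmogorov), `f` first. -/
def MPKernel.comp {x y z : PSBorel.{u}} (f : MPKernel x y) (g : MPKernel y z) : MPKernel x z where
  ker := g.ker ∘ₖ f.ker
  preserves := by rw [← Measure.comp_assoc, f.preserves, g.preserves]

theorem MPKernel.comp_congr {x y z : PSBorel.{u}} {f f' : MPKernel x y} {g g' : MPKernel y z}
    (hf : f ≈ f') (hg : g ≈ g') : f.comp g ≈ f'.comp g' := by
  rw [equiv_iff_ae] at hf hg ⊢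
  have hg' : ∀ᵐ a ∂(x.law : Measure x.carrier), ∀ᵐ b ∂(f.ker a), g.ker b = g'.ker b := by
    refine Measure.ae_ae_of_ae_comp ?_
    rw [f.preserves]
    exact hg
  filter_upwards [hf, hg'] with a ha hb
  change (g.ker ∘ₖ f.ker) a = (g'.ker ∘ₖ f'.ker) a
  rw [Kernel.comp_apply, Kernel.comp_apply, ← ha]
  exact Measure.bind_congr_right hb

theorem MPKernel.ext' {x y : PSBorel.{u}} {f g : MPKernel x y} (h : f.ker = g.ker) : f = g := by
  cases f
  cases g
  cases h
  rfl

/-- `PS(Borel)`: morphisms are measure-preserving Markov kernels modulo almost sure equality. -/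
instance : Category.{u} PSBorel.{u} where
  Hom x y := Quotient (setoid x y)
  id x := ⟦MPKernel.id x⟧
  comp f g := Quotient.map₂ MPKernel.comp
    (fun _ _ hf _ _ hg => MPKernel.comp_congr hf hg) f g
  id_comp f := by
    induction f using Quotient.inductionOn with | h f =>
    exact congrArg (Quotient.mk _) (MPKernel.ext' (Kernel.comp_id f.ker))
  comp_id f := by
    induction f using Quotient.inductionOn with | h f =>
    exact congrArg (Quotient.mk _) (MPKernel.ext' (Kernel.id_comp f.ker))
  assoc f g h := by
    induction f using Quotient.inductionOn with | h f =>
    induction g using Quotient.inductionOn with | h g =>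
    induction h using Quotient.inductionOn with | h h =>
    exact congrArg (Quotient.mk _)
      (MPKernel.ext' (Kernel.comp_assoc h.ker g.ker f.ker).symm)

/-- The morphism of `PS(Borel)` represented by a measure-preserving Markov kernel. -/
def homMk {x y : PSBorel.{u}} (k : Kernel x.carrier y.carrier) [IsMarkovKernel k]
    (hk : k ∘ₘ (x.law : Measure x.carrier) = y.law) : x ⟶ y :=
  Quotient.mk (setoid x y) ⟨k, hk⟩

/-- A morphism `f : (X, p) ⟶ (Y, q)` is almost surely deterministic if `copy ∘ f` and
`(f ⊗ f) ∘ copy` are `p`-almost surely equal (for any, equivalently all, representatives). -/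
def IsASDeterministic {x y : PSBorel.{u}} (f : x ⟶ y) : Prop :=
  Quotient.liftOn f
    (fun k : MPKernel x y => ASEq (x.law : Measure x.carrier)
      (Kernel.copy y.carrier ∘ₖ k.ker) ((k.ker ∥ₖ k.ker) ∘ₖ Kernel.copy x.carrier))
    (fun k l h => by
      rw [equiv_iff_ae] at h
      have h1 : Kernel.copy y.carrier ∘ₖ k.ker =ᵐ[(x.law : Measure x.carrier)]
          Kernel.copy y.carrier ∘ₖ l.ker := by
        filter_upwards [h] with a ha
        rw [Kernel.comp_apply, Kernel.comp_apply, ha]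
      have h2 : (k.ker ∥ₖ k.ker) ∘ₖ Kernel.copy x.carrier =ᵐ[(x.law : Measure x.carrier)]
          (l.ker ∥ₖ l.ker) ∘ₖ Kernel.copy x.carrier := by
        filter_upwards [h] with a ha
        rw [Kernel.parallelComp_comp_copy, Kernel.parallelComp_comp_copy, Kernel.prod_apply,
          Kernel.prod_apply, ha]
      simp only [asEq_iff_ae]
      exact propext ⟨fun h0 => h1.symm.trans (h0.trans h2), fun h0 => h1.trans (h0.trans h2.symm)⟩)

/-- `g : (Y, q) ⟶ (X, p)` is a Bayesian inverse of `f : (X, p) ⟶ (Y, q)`: the joint distributions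
`f(dy|x) p(dx)` and `g(dx|y) q(dy)` agree. -/
def IsBayesianInverse {x y : PSBorel.{u}} (f : x ⟶ y) (g : y ⟶ x) : Prop :=
  Quotient.liftOn₂ f g
    (fun (k : MPKernel x y) (l : MPKernel y x) =>
      (y.law : Measure y.carrier) ⊗ₘ l.ker
        = ((x.law : Measure x.carrier) ⊗ₘ k.ker).map Prod.swap)
    (fun k l k' l' hk hl => by
      rw [equiv_iff_ae] at hk hl
      simp only [Measure.compProd_congr hk, Measure.compProd_congr hl])

/-! ### Dynamical systems, limits and invariant objects

A dynamical system in a category with monoid `M` is a functor from the one-object category of `M`.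
-/

section DynamicalSystem

variable {M : Type w} [Monoid M] {C : Type*} [Category C]

/-- Left-invariant morphisms: `m ∘ h = h` for all `m`. -/
def LeftInvariant (D : SingleObj M ⥤ C) {a : C} (h : a ⟶ D.obj (SingleObj.star M)) : Prop :=
  ∀ m : M, h ≫ D.map (X := SingleObj.star M) (Y := SingleObj.star M) m = h

/-- Right-invariant morphisms: `f ∘ m = f` for all `m`. -/
def RightInvariant (D : SingleObj M ⥤ C) {y : C} (f : D.obj (SingleObj.star M) ⟶ y) : Prop :=
  ∀ m : M, D.map (X := SingleObj.star M) (Y := SingleObj.star M) m ≫ f = f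

/-- The cone over a dynamical system given by a left-invariant morphism. -/
def coneOf (D : SingleObj M ⥤ C) {a : C} (h : a ⟶ D.obj (SingleObj.star M))
    (hh : LeftInvariant D h) : Cone D where
  pt := a
  π :=
    { app := fun _ => h
      naturality := fun _ _ m => (Category.id_comp _).trans (hh m).symm }

/-- The cocone under a dynamical system given by a right-invariant morphism. -/
def coconeOf (D : SingleObj M ⥤ C) {y : C} (f : D.obj (SingleObj.star M) ⟶ y)
    (hf : RightInvariant D f) : Cocone D where
  pt := y
  ι :=
    { app := fun _ => f
      naturality := fun _ _ m => (hf m).trans (Category.comp_id _).symm }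

/-- `ℓ` is a limiting cone over the dynamical system `D`. -/
def IsLimitingCone (D : SingleObj M ⥤ C) {a : C} (ℓ : a ⟶ D.obj (SingleObj.star M)) : Prop :=
  ∃ h : LeftInvariant D ℓ, Nonempty (IsLimit (coneOf D ℓ h))

/-- `r : (X, p) ⟶ y` exhibits `y` as an invariant object of the dynamical system `D` on `(X, p)`:
it is a colimit of `D`, and a right-invariant `f` is almost surely deterministic if and only if
the morphism out of `y` that it induces is. -/
def IsInvariantObject (D : SingleObj M ⥤ PSBorel.{u}) {y : PSBorel.{u}}
    (r : D.obj (SingleObj.star M) ⟶ y) : Prop :=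
  ∃ (hr : RightInvariant D r) (hc : IsColimit (coconeOf D r hr)),
    ∀ (z : PSBorel.{u}) (f : D.obj (SingleObj.star M) ⟶ z) (hf : RightInvariant D f),
      IsASDeterministic f ↔ IsASDeterministic (hc.desc (coconeOf D f hf))

end DynamicalSystem

end PSBorel

/-! ### Finite permutations and exchangeable measures -/

/-- The group `S_∞` of finite permutations of `ℕ`. -/
def FinPerm : Subgroup (Equiv.Perm ℕ) where
  carrier := {σ | {i | σ i ≠ i}.Finite}
  one_mem' := by simp
  mul_mem' := by
    intro σ τ hσ hτ
    refine (Set.Finite.union hσ hτ).subset fun i hi => ?_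
    by_contra h
    simp only [Set.mem_union, Set.mem_ofPred_eq, not_or, not_not] at h
    exact hi (by rw [Equiv.Perm.mul_apply, h.2, h.1])
  inv_mem' := by
    intro σ hσ
    refine Set.Finite.subset hσ fun i hi h => hi ?_
    rw [Equiv.Perm.inv_eq_iff_eq]
    exact h.symm

section DeFinetti

variable (X : Type u) [MeasurableSpace X]

/-- The action of a permutation on sequences, `(x_i)_i ↦ (x_{σ⁻¹ i})_i`. -/
def permute (σ : Equiv.Perm ℕ) (x : ℕ → X) : ℕ → X := fun i => x (σ⁻¹ i)

theorem measurable_permute (σ : Equiv.Perm ℕ) : Measurable (permute X σ) :=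
  measurable_pi_lambda _ fun i => measurable_pi_apply (σ⁻¹ i)

/-- The deterministic kernel given by permuting the components. -/
def permKernel (σ : Equiv.Perm ℕ) : Kernel (ℕ → X) (ℕ → X) :=
  Kernel.deterministic (permute X σ) (measurable_permute X σ)

instance (σ : Equiv.Perm ℕ) : IsMarkovKernel (permKernel X σ) := by
  unfold permKernel
  infer_instance

variable {X}

/-- A probability measure on `X^ℕ` is exchangeable if it is invariant under all finite
permutations. -/
def Exchangeable (p : ProbabilityMeasure (ℕ → X)) : Prop :=
  ∀ σ ∈ FinPerm, permKernel X σ ∘ₘ (p : Measure (ℕ → X)) = p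

variable (X)

/-- `copy_ℕ`, the deterministic kernel `x ↦ (x, x, x, …)`. -/
def copyN : Kernel X (ℕ → X) :=
  Kernel.deterministic (fun x _ => x) (measurable_pi_lambda _ fun _ => measurable_id)

instance : IsMarkovKernel (copyN X) := by
  unfold copyN
  infer_instance

/-- The sampling kernel `samp : PX → X`, `q ↦ q`. -/
def samp : Kernel (ProbabilityMeasure X) X where
  toFun q := (q : Measure X)
  measurable' := measurable_subtype_coe

instance : IsMarkovKernel (samp X) := ⟨fun q => q.2⟩

/-- `samp^ℕ`, the countable product of the sampling kernel: `(q_n)_n ↦ ⨂_n q_n`. -/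
def sampN : Kernel (ℕ → ProbabilityMeasure X) (ℕ → X) where
  toFun q := Measure.infinitePi fun n => samp X (q n)
  measurable' := by
    refine Measurable.measure_of_isPiSystem_of_isProbabilityMeasure
      generateFrom_squareCylinders.symm
      (isPiSystem_squareCylinders (fun _ => MeasurableSpace.isPiSystem_measurableSet)
        (fun _ => MeasurableSet.univ)) ?_
    rintro _ ⟨s, t, ht, rfl⟩
    have ht' : ∀ i, MeasurableSet (t i) := fun i => ht i (Set.mem_univ i)
    have h (q : ℕ → ProbabilityMeasure X) : Measure.infinitePi (fun n => samp X (q n))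
        ((s : Set ℕ).pi t) = ∏ i ∈ s, samp X (q i) (t i) :=
      Measure.infinitePi_pi _ fun i _ => ht' i
    simp only [h]
    exact Finset.measurable_prod _ fun i _ =>
      ((samp X).measurable_coe (ht' i)).comp (measurable_pi_apply i)

instance : IsMarkovKernel (sampN X) :=
  ⟨fun q => inferInstanceAs (IsProbabilityMeasure (Measure.infinitePi fun n => samp X (q n)))⟩

variable {X}

/-- The law `copy_ℕ ∘ μ` on `(PX)^ℕ`. -/
def copyLaw (μ : ProbabilityMeasure (ProbabilityMeasure X)) :
    ProbabilityMeasure (ℕ → ProbabilityMeasure X) :=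
  ⟨copyN (ProbabilityMeasure X) ∘ₘ (μ : Measure (ProbabilityMeasure X)), inferInstance⟩

variable [StandardBorelSpace X]

/-- The dynamical system in `PS(Borel)` given by the action of `S_∞` on `(X^ℕ, p)`, for an
exchangeable measure `p`. -/
def permSystem (p : ProbabilityMeasure (ℕ → X)) (hp : Exchangeable p) :
    SingleObj FinPerm ⥤ PSBorel.{u} where
  obj _ := PSBorel.of (ℕ → X) p
  map := fun {_ _} (σ : FinPerm) => PSBorel.homMk (permKernel X σ.1) (hp σ.1 σ.2)
  map_id _ := congrArg (Quotient.mk _) (PSBorel.MPKernel.ext' rfl)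
  map_comp f g := congrArg (Quotient.mk _) (PSBorel.MPKernel.ext'
    (Kernel.deterministic_comp_deterministic (measurable_permute X f.1)
      (measurable_permute X g.1)).symm)

/-- The morphism `(PX, μ) ⟶ ((PX)^ℕ, copy_ℕ ∘ μ) ⟶ (X^ℕ, p)` of `PS(Borel)` given by `copy_ℕ`
followed by `samp^ℕ`, when `samp^ℕ ∘ copy_ℕ ∘ μ = p`. -/
def sampCopy (p : ProbabilityMeasure (ℕ → X)) (μ : ProbabilityMeasure (ProbabilityMeasure X))
    (h : sampN X ∘ₘ (copyN (ProbabilityMeasure X) ∘ₘ (μ : Measure (ProbabilityMeasure X))) = p) :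
    PSBorel.of (ProbabilityMeasure X) μ ⟶ PSBorel.of (ℕ → X) p :=
  (PSBorel.homMk (copyN (ProbabilityMeasure X)) rfl :
    PSBorel.of (ProbabilityMeasure X) μ
      ⟶ PSBorel.of (ℕ → ProbabilityMeasure X) (copyLaw μ)) ≫
  (PSBorel.homMk (sampN X) h :
    PSBorel.of (ℕ → ProbabilityMeasure X) (copyLaw μ) ⟶ PSBorel.of (ℕ → X) p)

end DeFinetti

end

end ASDeFinetti

open ASDeFinetti

/-! Everything rests on one measurable map `R` from sequences to `PX`, read off from limiting
empirical frequencies and chosen independently of the exchangeable measure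
(`exists_directing_measure`). It satisfies `R = q` almost surely under `iid X q`, and every finite
exchangeable measure `ν` is the mixture of the iid laws with mixing measure `ν.map R`.

The first property is the strong law of large numbers. For the second, a variance bound using only
transpositions makes the frequencies converge along powers of two (`tendsto_empFreq`).
Exchangeability then lets the indicator of one coordinate be replaced by the limiting frequency
(`integral_mul_hit`), and iterating this gives conditional independence (`integral_prod_hit_mul`).

Uniqueness of `μ` follows because pushing a mixture forward along `R` returns its mixing measure. In
the category, the mixture kernel `ℓ` and the deterministic `r` given by `R` split an idempotent on
`(X^ℕ, p)`. It fixes left-invariant morphisms: almost every value of such a kernel is exchangeable,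
so de Finetti applies pointwise with the same `R`. It fixes right-invariant morphisms: de Finetti
applies to `p` weighted by an invariant density, again with the same `R`
(`setLIntegral_eq_of_invariant`). So `ℓ` is a limit and `r` a colimit. Determinism passes through
`r` because `r` is itself deterministic, and `ℓ` and `r` are Bayesian inverses because `q = R x`
almost surely under the joint law (`compProd_iid`). -/

namespace ASDeFinetti

open Filter Topology

/-! ### Empirical frequencies under exchangeable measures -/

section EmpiricalFrequency

variable {X : Type*}

theorem swap_mem_finPerm (i j : ℕ) : Equiv.swap i j ∈ FinPerm := by
  refine Set.Finite.subset (Set.toFinite {i, j}) fun k hk => ?_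
  by_contra h
  simp only [Set.mem_insert_iff, Set.mem_singleton_iff, not_or] at h
  exact hk (Equiv.swap_apply_of_ne_of_ne h.1 h.2)

/-- The indicator of the event that the `i`-th component lies in `A`. -/
noncomputable def hit (A : Set X) (i : ℕ) (x : ℕ → X) : ℝ := A.indicator 1 (x i)

theorem hit_nonneg (A : Set X) (i : ℕ) (x : ℕ → X) : 0 ≤ hit A i x :=
  Set.indicator_nonneg (fun _ _ => zero_le_one) _

theorem hit_le_one (A : Set X) (i : ℕ) (x : ℕ → X) : hit A i x ≤ 1 :=
  Set.indicator_le_self' (fun _ _ => zero_le_one) _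

theorem hit_permute (A : Set X) (i : ℕ) (σ : Equiv.Perm ℕ) (x : ℕ → X) :
    hit A i (permute X σ x) = hit A (σ⁻¹ i) x := rfl

/-- The frequency of visits to `A` among the first `n` components. -/
noncomputable def empFreq (A : Set X) (n : ℕ) (x : ℕ → X) : ℝ :=
  (n : ℝ)⁻¹ * ∑ i ∈ Finset.range n, hit A i x

theorem empFreq_nonneg (A : Set X) (n : ℕ) (x : ℕ → X) : 0 ≤ empFreq A n x :=
  mul_nonneg (by positivity) (Finset.sum_nonneg fun i _ => hit_nonneg A i x)

theorem empFreq_le_one (A : Set X) (n : ℕ) (x : ℕ → X) : empFreq A n x ≤ 1 := by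
  have h : ∑ i ∈ Finset.range n, hit A i x ≤ n := by
    simpa using Finset.sum_le_sum fun i (_ : i ∈ Finset.range n) => hit_le_one A i x
  rcases n.eq_zero_or_pos with rfl | hn
  · simp [empFreq]
  · rw [empFreq, inv_mul_le_iff₀ (by exact_mod_cast hn)]
    simpa using h

/-- The limiting frequency of visits to `A`, along the powers of two. -/
noncomputable def limFreq (A : Set X) (x : ℕ → X) : ℝ :=
  limsup (fun k : ℕ => empFreq A (2 ^ k) x) atTop

theorem limFreq_nonneg (A : Set X) (x : ℕ → X) : 0 ≤ limFreq A x :=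
  le_limsup_of_frequently_le (Frequently.of_forall fun _ => empFreq_nonneg _ _ _)
    (isBoundedUnder_of ⟨1, fun _ => empFreq_le_one _ _ _⟩)

theorem limFreq_le_one (A : Set X) (x : ℕ → X) : limFreq A x ≤ 1 :=
  limsup_le_of_le (isBoundedUnder_of ⟨0, fun _ => empFreq_nonneg _ _ _⟩).isCoboundedUnder_flip
    (Eventually.of_forall fun _ => empFreq_le_one _ _ _)

/-- Once `n` exceeds the support of the permutation, the first `n` indices are only rearranged among
themselves. -/
theorem empFreq_permute (A : Set X) {σ : Equiv.Perm ℕ} (hσ : σ ∈ FinPerm) (x : ℕ → X) :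
    ∀ᶠ n in atTop, empFreq A n (permute X σ x) = empFreq A n x := by
  have hfin : {i | σ⁻¹ i ≠ i}.Finite := FinPerm.inv_mem hσ
  obtain ⟨N, hN⟩ := hfin.bddAbove
  filter_upwards [eventually_gt_atTop N] with n hn
  have hfix : ∀ i, i ∉ Finset.range n → σ⁻¹ i = i := fun i hi => by
    by_contra h
    exact absurd (hN h) (by simp only [Finset.mem_range] at hi; omega)
  rw [empFreq, empFreq]
  congr 1
  refine Equiv.Perm.sum_comp σ⁻¹ (Finset.range n) (fun i => hit A i x) fun i hi => ?_
  by_contra h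
  exact hi (hfix i (by simpa using h))

theorem limFreq_permute (A : Set X) {σ : Equiv.Perm ℕ} (hσ : σ ∈ FinPerm) (x : ℕ → X) :
    limFreq A (permute X σ x) = limFreq A x :=
  limsup_congr ((tendsto_pow_atTop_atTop_of_one_lt one_lt_two).eventually
    (empFreq_permute A hσ x))

/-- Pairing index `i` with `n + i` writes the increment as a sum of terms, each of which changes
sign under its own transposition. -/
theorem empFreq_two_mul_sub (A : Set X) (n : ℕ) (x : ℕ → X) :
    empFreq A (2 * n) x - empFreq A n x
      = (2 * n : ℝ)⁻¹ * ∑ i ∈ Finset.range n, (hit A (n + i) x - hit A i x) := by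
  rw [empFreq, empFreq, two_mul, Finset.sum_range_add, Finset.sum_sub_distrib]
  rcases n.eq_zero_or_pos with rfl | hn
  · simp
  · have : (n : ℝ) ≠ 0 := by positivity
    push_cast
    field_simp
    ring

theorem limFreq_univ (x : ℕ → X) : limFreq Set.univ x = 1 := by
  have h (k : ℕ) : empFreq Set.univ (2 ^ k) x = 1 := by simp [empFreq, hit]
  simp [limFreq, h]

variable [MeasurableSpace X]

/-- A measure on `X^ℕ` is invariant under all transpositions (equivalently, exchangeable). -/
def SwapInvariant (ν : Measure (ℕ → X)) : Prop :=
  ∀ i j, ν.map (permute X (Equiv.swap i j)) = ν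

theorem SwapInvariant.integral_permute {ν : Measure (ℕ → X)} (hν : SwapInvariant ν) (i j : ℕ)
    {F : (ℕ → X) → ℝ} (hF : Measurable F) :
    ∫ x, F (permute X (Equiv.swap i j) x) ∂ν = ∫ x, F x ∂ν := by
  conv_rhs => rw [← hν i j]
  rw [integral_map (measurable_permute X _).aemeasurable hF.aestronglyMeasurable]

theorem measurable_hit {A : Set X} (hA : MeasurableSet A) (i : ℕ) : Measurable (hit A i) :=
  (measurable_one.indicator hA).comp (measurable_pi_apply i)

theorem measurable_empFreq {A : Set X} (hA : MeasurableSet A) (n : ℕ) :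
    Measurable (empFreq A n) :=
  (Finset.measurable_fun_sum _ fun i _ => measurable_hit hA i).const_mul _

theorem measurable_limFreq {A : Set X} (hA : MeasurableSet A) : Measurable (limFreq A) :=
  Measurable.limsup fun k => measurable_empFreq hA (2 ^ k)

theorem integrable_of_bound {ν : Measure (ℕ → X)} [IsFiniteMeasure ν] {F : (ℕ → X) → ℝ}
    (hF : Measurable F) {c : ℝ} (hc : ∀ x, |F x| ≤ c) : Integrable F ν :=
  Integrable.of_bound hF.aestronglyMeasurable c (Eventually.of_forall hc)

/-- The paired differences are orthogonal in `L²`, so only the `n` diagonal terms survive, against a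
prefactor of order `n⁻²`. -/
theorem integral_sq_empFreq_sub_le {ν : Measure (ℕ → X)} [IsFiniteMeasure ν]
    (hν : SwapInvariant ν) {A : Set X} (hA : MeasurableSet A) (n : ℕ) :
    ∫ x, (empFreq A (2 * n) x - empFreq A n x) ^ 2 ∂ν ≤ ν.real Set.univ * (n : ℝ)⁻¹ := by
  set D : ℕ → (ℕ → X) → ℝ := fun i x => hit A (n + i) x - hit A i x with hD
  have hDm (i : ℕ) : Measurable (D i) := (measurable_hit hA _).sub (measurable_hit hA _)
  have hD1 (i : ℕ) (x : ℕ → X) : |D i x| ≤ 1 := by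
    rw [abs_le]
    constructor <;> simp only [hD] <;>
      linarith [hit_nonneg A i x, hit_le_one A i x, hit_nonneg A (n + i) x, hit_le_one A (n + i) x]
  have hDD (i j : ℕ) (x : ℕ → X) : |D i x * D j x| ≤ 1 := by
    rw [abs_mul]
    exact mul_le_one₀ (hD1 i x) (abs_nonneg _) (hD1 j x)
  have hint (i j : ℕ) : Integrable (fun x => D i x * D j x) ν :=
    integrable_of_bound ((hDm i).mul (hDm j)) (hDD i j)
  -- Swapping `i` with `n + i` negates `D i` and leaves `D j` alone, so the integral equals its own
  -- negative.
  have hoff (i j : ℕ) (hi : i < n) (hj : j < n) (hij : i ≠ j) : ∫ x, D i x * D j x ∂ν = 0 := by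
    have h := hν.integral_permute i (n + i) ((hDm i).mul (hDm j))
    have h' (x : ℕ → X) : (D i * D j) (permute X (Equiv.swap i (n + i)) x)
        = -(D i x * D j x) := by
      simp only [Pi.mul_apply, hD, hit_permute, Equiv.swap_inv, Equiv.swap_apply_left,
        Equiv.swap_apply_right]
      rw [Equiv.swap_apply_of_ne_of_ne (a := i) (b := n + i) (x := n + j) (by omega) (by omega),
        Equiv.swap_apply_of_ne_of_ne (a := i) (b := n + i) (x := j) (by omega) (by omega)]
      ring
    simp only [h', integral_neg] at h
    simp only [Pi.mul_apply] at h
    linarith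
  have hdiag (i : ℕ) : ∫ x, D i x * D i x ∂ν ≤ ν.real Set.univ := by
    calc ∫ x, D i x * D i x ∂ν ≤ ∫ _, (1 : ℝ) ∂ν :=
          integral_mono (hint i i) (integrable_const _) fun x => (le_abs_self _).trans (hDD i i x)
      _ = ν.real Set.univ := by simp
  have hsq (x : ℕ → X) : (empFreq A (2 * n) x - empFreq A n x) ^ 2
      = ((2 * n : ℝ)⁻¹) ^ 2 * ∑ i ∈ Finset.range n, ∑ j ∈ Finset.range n, D i x * D j x := by
    rw [empFreq_two_mul_sub, mul_pow, sq (∑ i ∈ Finset.range n, _), Finset.sum_mul_sum]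
  simp only [hsq]
  rw [integral_const_mul,
    integral_finsetSum _ fun i _ => integrable_finsetSum _ fun j _ => hint i j]
  have hle : ∑ i ∈ Finset.range n, ∫ x, ∑ j ∈ Finset.range n, D i x * D j x ∂ν
      ≤ n * ν.real Set.univ := by
    have : ∀ i ∈ Finset.range n, ∫ x, ∑ j ∈ Finset.range n, D i x * D j x ∂ν
        ≤ ν.real Set.univ := fun i hi => by
      rw [integral_finsetSum _ fun j _ => hint i j, Finset.sum_eq_single_of_mem i hi]
      · exact hdiag i
      · exact fun j hj hji =>
          hoff i j (Finset.mem_range.1 hi) (Finset.mem_range.1 hj) hji.symm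
    simpa using Finset.sum_le_sum this
  rcases n.eq_zero_or_pos with rfl | hn
  · simp
  · have hn' : (0 : ℝ) < n := by exact_mod_cast hn
    calc ((2 * n : ℝ)⁻¹) ^ 2 * _ ≤ ((2 * n : ℝ)⁻¹) ^ 2 * (n * ν.real Set.univ) := by gcongr
      _ = ν.real Set.univ * (n : ℝ)⁻¹ / 4 := by field_simp; ring
      _ ≤ ν.real Set.univ * (n : ℝ)⁻¹ := by
        have : 0 ≤ ν.real Set.univ * (n : ℝ)⁻¹ := by positivity
        linarith

/-- Under an exchangeable measure the frequencies converge almost surely. -/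
theorem tendsto_empFreq {ν : Measure (ℕ → X)} [IsFiniteMeasure ν]
    (hν : SwapInvariant ν) {A : Set X} (hA : MeasurableSet A) :
    ∀ᵐ x ∂ν, Tendsto (fun k : ℕ => empFreq A (2 ^ k) x) atTop (𝓝 (limFreq A x)) := by
  set d : ℕ → (ℕ → X) → ℝ := fun k x => empFreq A (2 ^ (k + 1)) x - empFreq A (2 ^ k) x with hd
  have hdm (k : ℕ) : Measurable (d k) := (measurable_empFreq hA _).sub (measurable_empFreq hA _)
  have hd1 (k : ℕ) (x : ℕ → X) : |d k x| ≤ 1 := by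
    rw [abs_le]
    constructor <;> simp only [hd] <;>
      linarith [empFreq_nonneg A (2 ^ k) x, empFreq_le_one A (2 ^ k) x,
        empFreq_nonneg A (2 ^ (k + 1)) x, empFreq_le_one A (2 ^ (k + 1)) x]
  -- The weight base may be any number strictly between 1 and 2: the weighted second moments must
  -- stay summable against `2 ^ (-k)`, and the inverse weights must be summable too.
  have hdint (k : ℕ) : Integrable (fun x => (3 / 2 : ℝ) ^ k * d k x ^ 2) ν := by
    refine (integrable_of_bound (c := 1) ((hdm k).pow_const 2) fun x => ?_).const_mul _
    rw [abs_pow]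
    exact pow_le_one₀ (abs_nonneg _) (hd1 k x)
  have hbound (k : ℕ) : ∫⁻ x, ENNReal.ofReal ((3 / 2 : ℝ) ^ k * d k x ^ 2) ∂ν
      ≤ ENNReal.ofReal (ν.real Set.univ * (3 / 4 : ℝ) ^ k) := by
    rw [← ofReal_integral_eq_lintegral_ofReal (hdint k)
      (Eventually.of_forall fun x => by positivity)]
    refine ENNReal.ofReal_le_ofReal ?_
    rw [integral_const_mul]
    have h := integral_sq_empFreq_sub_le hν hA (2 ^ k)
    rw [← pow_succ'] at h
    calc (3 / 2 : ℝ) ^ k * ∫ x, d k x ^ 2 ∂ν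
        ≤ (3 / 2 : ℝ) ^ k * (ν.real Set.univ * (((2 ^ k : ℕ) : ℝ))⁻¹) := by gcongr
      _ = ν.real Set.univ * (3 / 4 : ℝ) ^ k := by
        rw [show (3 / 4 : ℝ) = 3 / 2 * 2⁻¹ by norm_num, mul_pow, inv_pow]
        push_cast
        ring
  have hfin : ∫⁻ x, ∑' k, ENNReal.ofReal ((3 / 2 : ℝ) ^ k * d k x ^ 2) ∂ν ≠ ⊤ := by
    rw [lintegral_tsum fun k =>
      (((hdm k).pow_const 2).const_mul _).ennreal_ofReal.aemeasurable]
    have hs : Summable fun k : ℕ => ν.real Set.univ * (3 / 4 : ℝ) ^ k :=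
      (summable_geometric_of_lt_one (by norm_num) (by norm_num)).mul_left _
    exact ((ENNReal.tsum_le_tsum hbound).trans_lt hs.tsum_ofReal_lt_top).ne
  have hae := ae_lt_top' (AEMeasurable.tsum fun k =>
    (((hdm k).pow_const 2).const_mul _).ennreal_ofReal.aemeasurable) hfin
  filter_upwards [hae] with x hx
  have hs : Summable fun k : ℕ => (3 / 2 : ℝ) ^ k * d k x ^ 2 := by
    have := ENNReal.summable_toReal hx.ne
    refine this.congr fun k => ENNReal.toReal_ofReal (by positivity)
  have hg : Summable fun k : ℕ => (2 / 3 : ℝ) ^ k :=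
    summable_geometric_of_lt_one (by norm_num) (by norm_num)
  -- With `w = (3 / 2) ^ k`, expanding `(w * |d| - 1) ^ 2 ≥ 0` gives `2 * |d| ≤ w * d ^ 2 + w⁻¹`,
  -- and both terms on the right are summable.
  have hsum : Summable fun k => |d k x| := by
    refine Summable.of_nonneg_of_le (fun k => abs_nonneg _) (fun k => ?_) (hs.add hg)
    have h1 : (3 / 2 : ℝ) ^ k * (2 / 3 : ℝ) ^ k = 1 := by
      rw [← mul_pow]; norm_num
    have h2 : 0 < (3 / 2 : ℝ) ^ k := by positivity
    have h3 : 0 < (2 / 3 : ℝ) ^ k := by positivity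
    rw [← sq_abs (d k x)]
    nlinarith [sq_nonneg ((3 / 2 : ℝ) ^ k * |d k x| - 1), abs_nonneg (d k x)]
  have hc : CauchySeq fun k : ℕ => empFreq A (2 ^ k) x := by
    refine cauchySeq_of_summable_dist (hsum.congr fun k => ?_)
    rw [dist_comm, Real.dist_eq]
  obtain ⟨l, hl⟩ := cauchySeq_tendsto_of_complete hc
  rwa [limFreq, hl.limsup_eq]

/-- A component can be replaced by the limiting frequency. -/
theorem integral_mul_hit {ν : Measure (ℕ → X)} [IsFiniteMeasure ν]
    (hν : SwapInvariant ν) {A : Set X} (hA : MeasurableSet A) {s : Finset ℕ} {m : ℕ}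
    {G : (ℕ → X) → ℝ} (hG : Measurable G) (hG1 : ∀ x, |G x| ≤ 1)
    (hGs : ∀ j ∉ s, ∀ x, G (permute X (Equiv.swap m j) x) = G x) :
    ∫ x, G x * hit A m x ∂ν = ∫ x, G x * limFreq A x ∂ν := by
  have hint (i : ℕ) : Integrable (fun x => G x * hit A i x) ν :=
    integrable_of_bound (c := 1) (hG.mul (measurable_hit hA i)) fun x => by
      rw [abs_mul, abs_of_nonneg (hit_nonneg A i x)]
      exact mul_le_one₀ (hG1 x) (hit_nonneg A i x) (hit_le_one A i x)
  -- Swapping `m` with an index beyond `s` fixes `G` and moves the indicator, so the integrals are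
  -- eventually constant in `j`; their Cesàro means then have the same limit.
  have hconst : ∀ᶠ j in atTop, ∫ x, G x * hit A j x ∂ν = ∫ x, G x * hit A m x ∂ν := by
    obtain ⟨N, hN⟩ := s.bddAbove
    filter_upwards [eventually_gt_atTop N] with j hj
    have hjs : j ∉ s := fun h => absurd (hN h) (by omega)
    refine Eq.trans ?_
      (hν.integral_permute m j (hG.mul (measurable_hit hA m)))
    refine integral_congr_ae (Eventually.of_forall fun x => ?_)
    simp only [hGs j hjs x, hit_permute, Equiv.swap_inv, Equiv.swap_apply_left]
  have h1 : Tendsto (fun k : ℕ => ∫ x, G x * empFreq A (2 ^ k) x ∂ν) atTop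
      (𝓝 (∫ x, G x * hit A m x ∂ν)) := by
    have := ((tendsto_const_nhds.congr' (hconst.mono fun _ h => h.symm)).cesaro).comp
      (tendsto_pow_atTop_atTop_of_one_lt (r := 2) one_lt_two)
    refine this.congr fun k => ?_
    simp only [Function.comp_apply, empFreq]
    rw [← integral_finsetSum _ fun i _ => hint i, ← integral_const_mul]
    refine integral_congr_ae (Eventually.of_forall fun x => ?_)
    simp only [Finset.mul_sum]
    exact Finset.sum_congr rfl fun i _ => by ring
  have h2 : Tendsto (fun k : ℕ => ∫ x, G x * empFreq A (2 ^ k) x ∂ν) atTop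
      (𝓝 (∫ x, G x * limFreq A x ∂ν)) := by
    refine tendsto_integral_of_dominated_convergence (fun _ => 1)
      (fun k => (hG.mul (measurable_empFreq hA _)).aestronglyMeasurable) (integrable_const _)
      (fun k => Eventually.of_forall fun x => ?_) ?_
    · rw [Real.norm_eq_abs, abs_mul, abs_of_nonneg (empFreq_nonneg _ _ _)]
      exact mul_le_one₀ (hG1 x) (empFreq_nonneg _ _ _) (empFreq_le_one _ _ _)
    · filter_upwards [tendsto_empFreq hν hA] with x hx
      exact hx.const_mul _
  exact tendsto_nhds_unique h1 h2

/-- Under an exchangeable measure, the components are conditionally independent given the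
limiting frequencies, and conditionally distributed according to them. -/
theorem integral_prod_hit_mul {ν : Measure (ℕ → X)} [IsFiniteMeasure ν]
    (hν : SwapInvariant ν) {A : ℕ → Set X} (hA : ∀ i, MeasurableSet (A i)) (s : Finset ℕ)
    {H : (ℕ → X) → ℝ} (hH : Measurable H) (hH1 : ∀ x, |H x| ≤ 1)
    (hHs : ∀ σ ∈ FinPerm, ∀ x, H (permute X σ x) = H x) :
    ∫ x, (∏ i ∈ s, hit (A i) i x) * H x ∂ν = ∫ x, (∏ i ∈ s, limFreq (A i) x) * H x ∂ν := by
  induction s using Finset.induction_on generalizing H with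
  | empty => simp
  | insert m s hm ih =>
    have hprod1 (x : ℕ → X) : |∏ i ∈ s, hit (A i) i x| ≤ 1 := by
      rw [Finset.abs_prod]
      refine Finset.prod_le_one (fun i _ => abs_nonneg _) fun i _ => ?_
      rw [abs_of_nonneg (hit_nonneg _ _ _)]
      exact hit_le_one _ _ _
    have h := integral_mul_hit hν (hA m) (s := s)
      (G := fun x => (∏ i ∈ s, hit (A i) i x) * H x)
      ((Finset.measurable_fun_prod _ fun i _ => measurable_hit (hA i) i).mul hH)
      (fun x => by
        rw [abs_mul]
        exact mul_le_one₀ (hprod1 x) (abs_nonneg _) (hH1 x))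
      -- Neither `m` nor `j` lies in `s`, so the transposition touches no factor of the product.
      (fun j hj x => by
        rw [hHs _ (swap_mem_finPerm m j)]
        congr 1
        refine Finset.prod_congr rfl fun i hi => ?_
        rw [hit_permute, Equiv.swap_inv, Equiv.swap_apply_of_ne_of_ne]
        · exact fun e => hm (e ▸ hi)
        · exact fun e => hj (e ▸ hi))
    -- The limiting frequency is itself invariant, so it can be absorbed into `H`; this is why the
    -- induction carries a general invariant factor.
    have h' := ih (H := fun x => limFreq (A m) x * H x) ((measurable_limFreq (hA m)).mul hH)
      (fun x => by
        rw [abs_mul, abs_of_nonneg (limFreq_nonneg _ _)]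
        exact mul_le_one₀ (limFreq_le_one _ _) (abs_nonneg _) (hH1 x))
      (fun σ hσ x => by rw [limFreq_permute _ hσ, hHs σ hσ])
    simp only [Finset.prod_insert hm]
    calc _ = ∫ x, (∏ i ∈ s, hit (A i) i x) * H x * hit (A m) m x ∂ν := by
          refine integral_congr_ae (Eventually.of_forall fun x => ?_); ring
      _ = ∫ x, (∏ i ∈ s, hit (A i) i x) * (limFreq (A m) x * H x) ∂ν := by
          rw [h]; refine integral_congr_ae (Eventually.of_forall fun x => ?_); ring
      _ = _ := by
          rw [h']; refine integral_congr_ae (Eventually.of_forall fun x => ?_); ring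

end EmpiricalFrequency

/-! ### Laws of iid sequences -/

section IID

variable (X : Type*) [MeasurableSpace X]

/-- The kernel `samp^ℕ ∘ copy_ℕ`, sending `q` to the law of an iid sequence with marginal `q`. -/
noncomputable def iid : Kernel (ProbabilityMeasure X) (ℕ → X) :=
  sampN X ∘ₖ copyN (ProbabilityMeasure X)

instance : IsMarkovKernel (iid X) := by
  unfold iid
  infer_instance

variable {X}

theorem iid_apply (q : ProbabilityMeasure X) :
    iid X q = Measure.infinitePi fun _ : ℕ => (q : Measure X) := by
  rw [iid, copyN, Kernel.comp_deterministic_eq_comap, Kernel.comap_apply]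
  rfl

theorem iid_pi (q : ProbabilityMeasure X) (s : Finset ℕ) {t : ℕ → Set X}
    (ht : ∀ i, MeasurableSet (t i)) :
    iid X q ((s : Set ℕ).pi t) = ∏ i ∈ s, (q : Measure X) (t i) := by
  rw [iid_apply]
  exact Measure.infinitePi_pi _ fun i _ => ht i

theorem iid_pushforward {Y : Type*} [MeasurableSpace Y] {f : X → Y} (hf : Measurable f)
    (q : ProbabilityMeasure X) :
    iid Y (pushforward f hf q) = (iid X q).map (fun x i => f (x i)) := by
  rw [iid_apply, iid_apply, Measure.infinitePi_map_pi _ fun _ => hf]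
  rfl

theorem map_permute_iid (q : ProbabilityMeasure X) (σ : Equiv.Perm ℕ) :
    (iid X q).map (permute X σ) = iid X q := by
  rw [iid_apply]
  exact Measure.map_infinitePi_infinitePi_of_inj (P := fun _ : ℕ => (q : Measure X))
    (σ⁻¹).injective

/-- The strong law of large numbers applied to the indicators, restricted to the subsequence of
powers of two. -/
theorem limFreq_iid (q : ProbabilityMeasure X) {A : Set X} (hA : MeasurableSet A) :
    ∀ᵐ x ∂(iid X q), limFreq A x = (q : Measure X).real A := by
  rw [iid_apply]
  set P := Measure.infinitePi fun _ : ℕ => (q : Measure X) with hP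
  have hind : Measurable (A.indicator (1 : X → ℝ)) := measurable_one.indicator hA
  have hmap (i : ℕ) : P.map (fun x => x i) = (q : Measure X) :=
    Measure.infinitePi_map_eval (fun _ : ℕ => (q : Measure X)) i
  have hident (i : ℕ) : IdentDistrib (hit A i) (hit A 0) P P := by
    refine ⟨(measurable_hit hA i).aemeasurable, (measurable_hit hA 0).aemeasurable, ?_⟩
    have h (j : ℕ) : P.map (hit A j) = (q : Measure X).map (A.indicator (1 : X → ℝ)) := by
      rw [← hmap j, Measure.map_map hind (measurable_pi_apply j)]
      rfl
    rw [h, h]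
  have hindep : Pairwise (Function.onFun (fun f g => IndepFun f g P) (hit A)) := fun i j hij =>
    (iIndepFun_infinitePi (P := fun _ : ℕ => (q : Measure X))
      (X := fun _ => A.indicator (1 : X → ℝ)) fun _ => hind).indepFun hij
  have hmean : ∫ x, hit A 0 x ∂P = (q : Measure X).real A := by
    rw [← integral_indicator_one hA, ← hmap 0,
      integral_map (measurable_pi_apply 0).aemeasurable hind.aestronglyMeasurable]
    rfl
  have hint : Integrable (hit A 0) P :=
    integrable_of_bound (c := 1) (measurable_hit hA 0) fun x => by
      rw [abs_of_nonneg (hit_nonneg _ _ _)]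
      exact hit_le_one _ _ _
  filter_upwards [strong_law_ae_real (hit A) hint hindep hident] with x hx
  rw [hmean] at hx
  have h2 := hx.comp (tendsto_pow_atTop_atTop_of_one_lt (r := 2) one_lt_two)
  refine Tendsto.limsup_eq (h2.congr fun k => ?_)
  simp only [Function.comp_apply, empFreq, div_eq_inv_mul]

end IID

/-! ### De Finetti's theorem for real sequences -/

section Real

/-- The limiting empirical distribution of a real sequence. -/
noncomputable def empLawReal (x : ℕ → ℝ) : ProbabilityMeasure ℝ :=
  ofRatCDF fun t : ℚ => limFreq (Set.Iic (t : ℝ)) x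

theorem measurable_limFreq_Iic :
    Measurable fun (x : ℕ → ℝ) (t : ℚ) => limFreq (Set.Iic (t : ℝ)) x :=
  measurable_pi_lambda _ fun _ => measurable_limFreq measurableSet_Iic

theorem measurable_empLawReal : Measurable empLawReal :=
  measurable_ofRatCDF.comp measurable_limFreq_Iic

theorem ratCDF_eq (q : ProbabilityMeasure ℝ) (t : ℚ) :
    ratCDF q t = (q : Measure ℝ).real (Set.Iic (t : ℝ)) :=
  cdf_eq_real _ _

/-- Only countably many half-lines are involved, so the strong law holds for all of them off one
null set, and `ofRatCDF` inverts `ratCDF`. -/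
theorem empLawReal_iid (q : ProbabilityMeasure ℝ) : ∀ᵐ x ∂(iid ℝ q), empLawReal x = q := by
  have h : ∀ᵐ x ∂(iid ℝ q), ∀ t : ℚ,
      limFreq (Set.Iic (t : ℝ)) x = (q : Measure ℝ).real (Set.Iic (t : ℝ)) :=
    ae_all_iff.2 fun t => limFreq_iid q measurableSet_Iic
  filter_upwards [h] with x hx
  rw [empLawReal, ← ofRatCDF_ratCDF q]
  congr 1
  funext t
  rw [hx t, ratCDF_eq]

/-- Almost surely under an exchangeable measure, the limiting frequencies are the
distribution function of the limiting empirical distribution. -/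
theorem ratCDF_empLawReal {ν : Measure (ℕ → ℝ)} [IsFiniteMeasure ν] (hν : SwapInvariant ν) :
    ∀ᵐ x ∂ν, ∀ t : ℚ,
      limFreq (Set.Iic (t : ℝ)) x = (empLawReal x : Measure ℝ).real (Set.Iic (t : ℝ)) := by
  set F : (ℕ → ℝ) → ℚ → ℝ := fun x t => limFreq (Set.Iic (t : ℝ)) x with hF
  have hFm : Measurable F := measurable_limFreq_Iic
  have hFx : Measurable fun x : ℕ → ℝ => (F x, x 0) := hFm.prodMk (measurable_pi_apply 0)
  -- Disintegrating the joint law of the frequencies and the first coordinate supplies a genuine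
  -- probability measure with distribution function `F x`. The axioms of a distribution function
  -- need not be checked for `F x` directly.
  set ρ : Measure ((ℚ → ℝ) × ℝ) := ν.map fun x => (F x, x 0) with hρ
  have hfst : ρ.fst = ν.map F := by
    rw [hρ, Measure.fst_map_prodMk (measurable_pi_apply 0)]
  have key (t : ℚ) : (fun l => ρ.condKernel l (Set.Iic (t : ℝ)))
      =ᵐ[ρ.fst] fun l => ENNReal.ofReal (l t) := by
    refine ae_eq_of_forall_setLIntegral_eq_of_sigmaFinite
      (Kernel.measurable_coe _ measurableSet_Iic) (measurable_pi_apply t).ennreal_ofReal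
      fun S hS _ => ?_
    rw [← Measure.compProd_apply_prod hS measurableSet_Iic, ρ.disintegrate, hfst,
      setLIntegral_map hS (measurable_pi_apply t).ennreal_ofReal hFm, hρ,
      Measure.map_apply hFx (hS.prod measurableSet_Iic)]
    -- The event `F ⁻¹' S` is permutation-invariant, so its indicator can serve as the factor `G` in
    -- `integral_mul_hit`.
    have hS' : MeasurableSet (F ⁻¹' S) := hFm hS
    have h := integral_mul_hit hν (measurableSet_Iic (a := (t : ℝ))) (s := ∅) (m := 0)
      (G := (F ⁻¹' S).indicator 1) (measurable_one.indicator hS')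
      (fun x => by
        by_cases hx : x ∈ F ⁻¹' S <;> simp [hx])
      (fun j _ x => by
        have : F (permute ℝ (Equiv.swap 0 j) x) = F x :=
          funext fun t => limFreq_permute _ (swap_mem_finPerm 0 j) x
        have hiff : permute ℝ (Equiv.swap 0 j) x ∈ F ⁻¹' S ↔ x ∈ F ⁻¹' S := by
          rw [Set.mem_preimage, Set.mem_preimage, this]
        by_cases hx : x ∈ F ⁻¹' S
        · rw [Set.indicator_of_mem (hiff.2 hx), Set.indicator_of_mem hx]
          rfl
        · rw [Set.indicator_of_notMem (hiff.not.2 hx), Set.indicator_of_notMem hx])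
    have h1 : ∫ x, (F ⁻¹' S).indicator 1 x * hit (Set.Iic (t : ℝ)) 0 x ∂ν
        = ν.real ((fun x => (F x, x 0)) ⁻¹' S ×ˢ Set.Iic (t : ℝ)) := by
      rw [← integral_indicator_one (hFx (hS.prod measurableSet_Iic))]
      refine integral_congr_ae (Eventually.of_forall fun x => ?_)
      by_cases h1 : F x ∈ S <;> by_cases h2 : x 0 ≤ t <;> simp [hit, h1, h2]
    have h2 : ∫ x, (F ⁻¹' S).indicator 1 x * limFreq (Set.Iic (t : ℝ)) x ∂ν
        = ∫ x in F ⁻¹' S, F x t ∂ν := by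
      rw [← integral_indicator hS']
      refine integral_congr_ae (Eventually.of_forall fun x => ?_)
      by_cases hx : x ∈ F ⁻¹' S
      · simp only [Set.indicator_of_mem hx, Pi.one_apply, one_mul]
        rfl
      · simp only [Set.indicator_of_notMem hx, zero_mul]
    rw [h1, h2] at h
    rw [← ofReal_integral_eq_lintegral_ofReal (f := fun x => F x t)
      (integrable_of_bound (c := 1) (measurable_limFreq measurableSet_Iic) fun x => by
        rw [abs_of_nonneg (limFreq_nonneg _ _)]
        exact limFreq_le_one _ _)
      (Eventually.of_forall fun x => limFreq_nonneg _ _), ← h, ofReal_measureReal]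
  have hae : ∀ᵐ x ∂ν, ∀ t : ℚ,
      ρ.condKernel (F x) (Set.Iic (t : ℝ)) = ENNReal.ofReal (F x t) := by
    refine ae_all_iff.2 fun t => ?_
    have h := key t
    rw [hfst] at h
    exact ae_of_ae_map hFm.aemeasurable h
  filter_upwards [hae] with x hx t
  let K : ProbabilityMeasure ℝ := ⟨ρ.condKernel (F x), inferInstance⟩
  have hcdf : ratCDF K = F x := by
    funext t
    rw [ratCDF_eq]
    change (ρ.condKernel (F x) (Set.Iic (t : ℝ))).toReal = F x t
    rw [hx t, ENNReal.toReal_ofReal (limFreq_nonneg _ _)]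
  have hlaw : empLawReal x = K := by
    rw [← ofRatCDF_ratCDF K, hcdf]
    rfl
  rw [hlaw, ← ratCDF_eq, hcdf]

/-- A finite measure on real sequences is determined by its values on finite products of half-lines
with rational endpoints. -/
theorem ext_of_pi_Iic_rat {ν ν' : Measure (ℕ → ℝ)} [IsFiniteMeasure ν]
    (h : ∀ (s : Finset ℕ) (t : ℕ → Set ℝ),
      (∀ i, t i ∈ insert Set.univ (Set.range fun r : ℚ => Set.Iic (r : ℝ))) →
      ν ((s : Set ℕ).pi t) = ν' ((s : Set ℕ).pi t)) : ν = ν' := by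
  -- The whole line is included so that cylinders over different finite index sets are closed under
  -- intersection.
  set C : Set (Set ℝ) := insert Set.univ (Set.range fun r : ℚ => Set.Iic (r : ℝ)) with hC
  have hCm : ∀ A ∈ C, MeasurableSet A := by
    rintro A (rfl | ⟨r, rfl⟩)
    exacts [MeasurableSet.univ, measurableSet_Iic]
  have hCpi : IsPiSystem C := by
    rintro A (rfl | ⟨a, rfl⟩) B (rfl | ⟨b, rfl⟩) -
    · simp [hC]
    · simp [hC]
    · simp [hC]
    · refine Or.inr ⟨min a b, ?_⟩
      simp only [Set.Iic_inter_Iic, Rat.cast_min]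
  have hgen : (MeasurableSpace.pi : MeasurableSpace (ℕ → ℝ))
      = MeasurableSpace.generateFrom (squareCylinders fun _ => C) := by
    refine le_antisymm (iSup_le fun i => ?_) ?_
    · rw [BorelSpace.measurable_eq (α := ℝ), Real.borel_eq_generateFrom_Iic_rat,
        MeasurableSpace.comap_generateFrom]
      refine MeasurableSpace.generateFrom_mono ?_
      rintro _ ⟨A, hA, rfl⟩
      obtain ⟨r, rfl⟩ := by simpa using hA
      exact ⟨{i}, fun _ => Set.Iic (r : ℝ), fun _ _ => Or.inr ⟨r, rfl⟩, by ext x; simp⟩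
    · refine MeasurableSpace.generateFrom_le ?_
      rintro _ ⟨s, t, ht, rfl⟩
      exact MeasurableSet.pi s.countable_toSet fun i _ => hCm _ (ht i trivial)
  refine ext_of_generate_finite _ hgen
    (isPiSystem_squareCylinders (fun _ => hCpi) fun _ => Set.mem_insert _ _) ?_ ?_
  · rintro _ ⟨s, t, ht, rfl⟩
    exact h s t fun i => ht i trivial
  · simpa using h ∅ (fun _ => Set.univ) fun _ => Set.mem_insert _ _

theorem iid_comp_map_empLawReal {ν : Measure (ℕ → ℝ)} [IsFiniteMeasure ν]
    (hν : SwapInvariant ν) : iid ℝ ∘ₘ ν.map empLawReal = ν := by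
  refine (ext_of_pi_Iic_rat fun s t ht => ?_).symm
  have htm (i : ℕ) : MeasurableSet (t i) := by
    rcases ht i with h | ⟨r, h⟩
    · rw [h]; exact MeasurableSet.univ
    · rw [← h]; exact measurableSet_Iic
  have hS : MeasurableSet ((s : Set ℕ).pi t) :=
    MeasurableSet.pi s.countable_toSet fun i _ => htm i
  rw [Measure.bind_apply hS (Kernel.aemeasurable _),
    lintegral_map (Kernel.measurable_coe _ hS) measurable_empLawReal]
  -- With `H = 1`, this says that the measure of a cylinder is the integral of a product of limiting
  -- frequencies, which is the mixture's value.
  have h := integral_prod_hit_mul hν htm s (H := 1) measurable_one (by simp) (by simp)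
  simp only [Pi.one_apply, mul_one] at h
  have hl : ∫ x, ∏ i ∈ s, hit (t i) i x ∂ν = ν.real ((s : Set ℕ).pi t) := by
    rw [← integral_indicator_one hS]
    refine integral_congr_ae (Eventually.of_forall fun x => ?_)
    simp only [hit]
    by_cases hx : x ∈ (s : Set ℕ).pi t
    · rw [Set.indicator_of_mem hx]
      exact Finset.prod_eq_one fun i hi => by simp [hx i hi]
    · rw [Set.indicator_of_notMem hx]
      obtain ⟨i, hi, hxi⟩ : ∃ i ∈ s, x i ∉ t i := by simpa [Set.mem_pi] using hx
      exact Finset.prod_eq_zero hi (by simp [hxi])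
  rw [← ofReal_measureReal, ← hl, h, ofReal_integral_eq_lintegral_ofReal
    (integrable_of_bound (c := 1)
      (Finset.measurable_fun_prod _ fun i _ => measurable_limFreq (htm i)) fun x => by
        rw [abs_of_nonneg (Finset.prod_nonneg fun i _ => limFreq_nonneg _ _)]
        exact Finset.prod_le_one (fun i _ => limFreq_nonneg _ _) fun i _ => limFreq_le_one _ _)
    (Eventually.of_forall fun x => Finset.prod_nonneg fun i _ => limFreq_nonneg _ _)]
  refine lintegral_congr_ae ?_
  filter_upwards [ratCDF_empLawReal hν] with x hx
  rw [iid_pi _ _ htm, ENNReal.ofReal_prod_of_nonneg fun i _ => limFreq_nonneg _ _]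
  refine Finset.prod_congr rfl fun i _ => ?_
  rcases ht i with h | ⟨r, h⟩
  · rw [h, limFreq_univ]; simp
  · rw [← h]
    change ENNReal.ofReal (limFreq (Set.Iic (r : ℝ)) x) = _
    rw [hx r, ofReal_measureReal]

end Real

/-! ### Transfer to standard Borel spaces -/

/-- **De Finetti's theorem**, with a directing measure that does not depend on the exchangeable
measure: there is a measurable map `R` from sequences to probability measures which recovers the
marginal of an iid sequence, and such that an exchangeable finite measure is the mixture of
the iid laws with marginals `R x`. -/
theorem exists_directing_measure (X : Type*) [MeasurableSpace X] [StandardBorelSpace X]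
    [Nonempty X] : ∃ R : (ℕ → X) → ProbabilityMeasure X, Measurable R ∧
      (∀ q, ∀ᵐ x ∂(iid X q), R x = q) ∧
      ∀ (ν : Measure (ℕ → X)) [IsFiniteMeasure ν], SwapInvariant ν →
        iid X ∘ₘ ν.map R = ν := by
  have he := measurableEmbedding_embeddingReal X
  set e := embeddingReal X
  obtain ⟨g, hg, hge⟩ := he.exists_measurable_extend (g := (id : X → X)) measurable_id
    fun _ => inferInstance
  have hge' (x : X) : g (e x) = x := congrFun hge x
  have heN : Measurable fun (x : ℕ → X) i => e (x i) :=
    measurable_pi_lambda _ fun i => he.measurable.comp (measurable_pi_apply i)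
  have hgN : Measurable fun (y : ℕ → ℝ) i => g (y i) :=
    measurable_pi_lambda _ fun i => hg.comp (measurable_pi_apply i)
  have hpush := measurable_pushforward g hg
  have hR : Measurable fun x : ℕ → X => pushforward g hg (empLawReal fun i => e (x i)) :=
    hpush.comp (measurable_empLawReal.comp heN)
  refine ⟨_, hR, fun q => ?_, fun ν _ hν => ?_⟩
  · have h := empLawReal_iid (pushforward e he.measurable q)
    rw [iid_pushforward] at h
    filter_upwards [ae_of_ae_map heN.aemeasurable h] with x hx
    rw [hx]
    refine Subtype.ext ?_
    change ((q : Measure X).map e).map g = q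
    rw [Measure.map_map hg he.measurable, hge, Measure.map_id]
  -- Coordinatewise embedding commutes with permutations, so the real case applies to the image;
  -- `g`, a left inverse of `e`, carries the result back.
  · have hν' : SwapInvariant (ν.map fun x i => e (x i)) := fun i j => by
      rw [Measure.map_map (measurable_permute ℝ _) heN]
      conv_rhs => rw [← hν i j]
      rw [Measure.map_map heN (measurable_permute X _)]
      rfl
    have h := congrArg (Measure.map fun (y : ℕ → ℝ) i => g (y i)) (iid_comp_map_empLawReal hν')
    rw [Measure.map_map hgN heN] at h
    have hid : ((fun (y : ℕ → ℝ) i => g (y i)) ∘ fun (x : ℕ → X) i => e (x i)) = id := by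
      funext x i
      exact hge' (x i)
    rw [hid, Measure.map_id] at h
    conv_rhs => rw [← h]
    ext S hS
    rw [Measure.map_apply hgN hS, Measure.bind_apply (hgN hS) (Kernel.aemeasurable _),
      Measure.bind_apply hS (Kernel.aemeasurable _),
      lintegral_map (Kernel.measurable_coe _ hS) hR,
      lintegral_map (Kernel.measurable_coe _ (hgN hS)) measurable_empLawReal,
      lintegral_map (f := fun y => iid ℝ (empLawReal y) ((fun y i => g (y i)) ⁻¹' S))
        ((Kernel.measurable_coe _ (hgN hS)).comp measurable_empLawReal) heN]
    refine lintegral_congr fun x => ?_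
    rw [iid_pushforward, Measure.map_apply hgN hS]

/-! ### Representatives of morphisms, determinism and split cones -/

namespace PSBorel

theorem exists_homMk {x y : PSBorel.{u}} (f : x ⟶ y) :
    ∃ (k : Kernel x.carrier y.carrier) (_ : IsMarkovKernel k)
      (hk : k ∘ₘ (x.law : Measure x.carrier) = y.law), f = homMk k hk := by
  induction f using Quotient.inductionOn with | h f =>
  exact ⟨f.ker, f.markov, f.preserves, rfl⟩

theorem homMk_eq_iff {x y : PSBorel.{u}} {k l : Kernel x.carrier y.carrier} [IsMarkovKernel k]
    [IsMarkovKernel l] {hk : k ∘ₘ (x.law : Measure x.carrier) = y.law}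
    {hl : l ∘ₘ (x.law : Measure x.carrier) = y.law} :
    homMk k hk = homMk l hl ↔ ASEq (x.law : Measure x.carrier) k l :=
  Quotient.eq

theorem homMk_eq_iff_ae {x y : PSBorel.{u}} {k l : Kernel x.carrier y.carrier} [IsMarkovKernel k]
    [IsMarkovKernel l] {hk : k ∘ₘ (x.law : Measure x.carrier) = y.law}
    {hl : l ∘ₘ (x.law : Measure x.carrier) = y.law} :
    homMk k hk = homMk l hl ↔ k =ᵐ[(x.law : Measure x.carrier)] l :=
  homMk_eq_iff.trans asEq_iff_ae

theorem homMk_comp {x y z : PSBorel.{u}} (k : Kernel x.carrier y.carrier)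
    (l : Kernel y.carrier z.carrier) [IsMarkovKernel k] [IsMarkovKernel l]
    (hk : k ∘ₘ (x.law : Measure x.carrier) = y.law)
    (hl : l ∘ₘ (y.law : Measure y.carrier) = z.law) :
    homMk k hk ≫ homMk l hl
      = homMk (l ∘ₖ k) (by rw [← Measure.comp_assoc, hk, hl]) := rfl

theorem id_eq_homMk (x : PSBorel.{u}) : 𝟙 x = homMk Kernel.id Measure.id_comp := rfl

/-- Precomposition with a deterministic measure-preserving map preserves and reflects almost sure
equality. -/
theorem asEq_comp_deterministic_iff {X Y Z : Type*} [MeasurableSpace X] [MeasurableSpace Y]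
    [MeasurableSpace Z] [StandardBorelSpace Z] {p : Measure X} [IsFiniteMeasure p] {R : X → Y}
    (hR : Measurable R) {k l : Kernel Y Z} [IsMarkovKernel k] [IsMarkovKernel l] :
    ASEq p (k ∘ₖ Kernel.deterministic R hR) (l ∘ₖ Kernel.deterministic R hR)
      ↔ ASEq (p.map R) k l := by
  have : IsFiniteMeasure (p.map R) := Measure.isFiniteMeasure_map p R
  constructor
  · intro h A B hA hB
    have h' := h (hR hA) hB
    simp only [Kernel.comp_deterministic_eq_comap, Kernel.comap_apply] at h'
    rwa [setLIntegral_map hA (Kernel.measurable_coe k hB) hR,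
      setLIntegral_map hA (Kernel.measurable_coe l hB) hR]
  · intro h
    rw [asEq_iff_ae] at h ⊢
    filter_upwards [ae_of_ae_map hR.aemeasurable h] with x hx
    simp only [Kernel.comp_deterministic_eq_comap, Kernel.comap_apply, hx]

/-- Precomposition with a deterministic morphism preserves and reflects determinism. -/
theorem isASDeterministic_comp_iff {x y z : PSBorel.{u}} {R : x.carrier → y.carrier}
    (hR : Measurable R)
    (hp : Kernel.deterministic R hR ∘ₘ (x.law : Measure x.carrier) = y.law) (g : y ⟶ z) :
    IsASDeterministic (homMk (Kernel.deterministic R hR) hp ≫ g) ↔ IsASDeterministic g := by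
  obtain ⟨k, _, hk, rfl⟩ := exists_homMk g
  rw [homMk_comp]
  have h1 : Kernel.copy z.carrier ∘ₖ (k ∘ₖ Kernel.deterministic R hR)
      = (Kernel.copy z.carrier ∘ₖ k) ∘ₖ Kernel.deterministic R hR :=
    (Kernel.comp_assoc _ _ _).symm
  -- This uses that `R` is deterministic: copying before or after applying it gives the same result.
  have h2 : ((k ∘ₖ Kernel.deterministic R hR) ∥ₖ (k ∘ₖ Kernel.deterministic R hR))
        ∘ₖ Kernel.copy x.carrier
      = ((k ∥ₖ k) ∘ₖ Kernel.copy y.carrier) ∘ₖ Kernel.deterministic R hR := by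
    ext1 a
    simp only [Kernel.parallelComp_comp_copy, Kernel.comp_deterministic_eq_comap,
      Kernel.comap_apply, Kernel.prod_apply]
  change ASEq _ (Kernel.copy z.carrier ∘ₖ (k ∘ₖ Kernel.deterministic R hR))
    (((k ∘ₖ Kernel.deterministic R hR) ∥ₖ (k ∘ₖ Kernel.deterministic R hR))
      ∘ₖ Kernel.copy x.carrier) ↔ ASEq _ (Kernel.copy z.carrier ∘ₖ k)
    ((k ∥ₖ k) ∘ₖ Kernel.copy y.carrier)
  rw [h1, h2, asEq_comp_deterministic_iff, ← hp, Measure.deterministic_comp_eq_map]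

section SplitCone

variable {M : Type w} [Monoid M] {C : Type*} [Category C] {D : SingleObj M ⥤ C} {a : C}
  {ℓ : a ⟶ D.obj (SingleObj.star M)} {r : D.obj (SingleObj.star M) ⟶ a}

/-- A left-invariant split monomorphism is a limiting cone if the idempotent that it splits fixes
all left-invariant morphisms. -/
theorem isLimitingCone_of_split (hℓ : LeftInvariant D ℓ) (hℓr : ℓ ≫ r = 𝟙 a)
    (h : ∀ (b : C) (f : b ⟶ D.obj (SingleObj.star M)), LeftInvariant D f → f ≫ r ≫ ℓ = f) :
    IsLimitingCone D ℓ := by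
  refine ⟨hℓ, ⟨{ lift := fun s => s.π.app (SingleObj.star M) ≫ r, fac := ?_, uniq := ?_ }⟩⟩
  · intro s j
    refine (Category.assoc _ _ _).trans (h _ _ fun m => ?_)
    exact s.w (j := SingleObj.star M) (j' := SingleObj.star M) m
  · intro s m hm
    have key (m : s.pt ⟶ a) : m = (m ≫ ℓ) ≫ r := by
      rw [Category.assoc, hℓr, Category.comp_id]
    exact (key m).trans (congrArg (· ≫ r) (hm (SingleObj.star M)))

/-- A right-invariant split epimorphism is a colimiting cocone if the idempotent that it splits
fixes all right-invariant morphisms. -/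
def isColimitCoconeOfSplit (hr : RightInvariant D r) (hℓr : ℓ ≫ r = 𝟙 a)
    (h : ∀ (b : C) (f : D.obj (SingleObj.star M) ⟶ b), RightInvariant D f → r ≫ ℓ ≫ f = f) :
    IsColimit (coconeOf D r hr) where
  desc s := ℓ ≫ s.ι.app (SingleObj.star M)
  fac s j := h _ _ fun m => s.w (j := SingleObj.star M) (j' := SingleObj.star M) m
  uniq s m hm := by
    have key (m : a ⟶ s.pt) : m = ℓ ≫ r ≫ m := by
      rw [← Category.assoc, hℓr, Category.id_comp]
    exact (key m).trans (congrArg (ℓ ≫ ·) (hm (SingleObj.star M)))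

end SplitCone

end PSBorel

/-! ### Mixtures of iid laws and their directing measure -/

section Mixture

variable {X : Type*} [MeasurableSpace X]

theorem Exchangeable.swapInvariant {p : ProbabilityMeasure (ℕ → X)} (hp : Exchangeable p) :
    SwapInvariant (p : Measure (ℕ → X)) := fun i j => by
  have h := hp _ (swap_mem_finPerm i j)
  rwa [permKernel, Measure.deterministic_comp_eq_map] at h

theorem sampN_comp_copyN_comp (μ : Measure (ProbabilityMeasure X)) :
    sampN X ∘ₘ (copyN (ProbabilityMeasure X) ∘ₘ μ) = iid X ∘ₘ μ := by
  rw [iid, Measure.comp_assoc]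

variable {R : (ℕ → X) → ProbabilityMeasure X} (hR : Measurable R)

theorem deterministic_comp_iid [StandardBorelSpace X] (hRq : ∀ q, ∀ᵐ x ∂(iid X q), R x = q) :
    Kernel.deterministic R hR ∘ₖ iid X = Kernel.id := by
  ext1 q
  rw [Kernel.comp_apply, Measure.deterministic_comp_eq_map, Kernel.id_apply,
    Measure.map_congr (g := fun _ => q) (hRq q), Measure.map_const, measure_univ, one_smul]

include hR in
/-- Integration against a mixture of iid laws, when `R` recovers the mixing parameter. -/
theorem lintegral_mixture (hRq : ∀ q, ∀ᵐ x ∂(iid X q), R x = q)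
    (μ : Measure (ProbabilityMeasure X)) {G : ProbabilityMeasure X → (ℕ → X) → ENNReal}
    (hG : Measurable (Function.uncurry G)) :
    ∫⁻ x, G (R x) x ∂(iid X ∘ₘ μ) = ∫⁻ q, ∫⁻ x, G q x ∂(iid X q) ∂μ := by
  have hm : Measurable fun x => G (R x) x := hG.comp (hR.prodMk measurable_id)
  rw [Measure.lintegral_bind (Kernel.aemeasurable _) hm.aemeasurable]
  refine lintegral_congr fun q => lintegral_congr_ae ?_
  filter_upwards [hRq q] with x hx
  rw [hx]

/-- Under the joint law of parameter and sequence, the parameter is almost surely `R` of the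
sequence, so conditioning on the sequence gives a Dirac mass. This is the Bayesian inversion. -/
theorem compProd_iid (hRq : ∀ q, ∀ᵐ x ∂(iid X q), R x = q)
    (μ : Measure (ProbabilityMeasure X)) [IsFiniteMeasure μ] :
    μ ⊗ₘ iid X = ((iid X ∘ₘ μ) ⊗ₘ Kernel.deterministic R hR).map Prod.swap := by
  ext S hS
  have h := lintegral_mixture hR hRq μ (G := fun q x => S.indicator 1 (q, x))
    (measurable_one.indicator hS)
  rw [Measure.map_apply measurable_swap hS,
    Measure.compProd_apply (measurable_swap hS), Measure.compProd_apply hS]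
  refine Eq.trans (lintegral_congr fun q => ?_) (h.symm.trans (lintegral_congr fun x => ?_))
  · rw [← lintegral_indicator_one (measurable_prodMk_left hS)]
    rfl
  · rw [Kernel.deterministic_apply' hR _ (measurable_prodMk_left (measurable_swap hS))]
    rfl

include hR in
/-- The directing measure is almost surely invariant under permutations. -/
theorem ae_directing_permute [StandardBorelSpace X] (hRq : ∀ q, ∀ᵐ x ∂(iid X q), R x = q)
    (μ : Measure (ProbabilityMeasure X)) (σ : Equiv.Perm ℕ) :
    ∀ᵐ x ∂(iid X ∘ₘ μ), R (permute X σ x) = R x := by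
  refine Measure.ae_comp_of_ae_ae
    (measurableSet_eq_fun (hR.comp (measurable_permute X σ)) hR)
    (Eventually.of_forall fun q => ?_)
  -- The law `iid X q` is permutation-invariant, so `R = q` also holds almost surely at the permuted
  -- sequence.
  have h := hRq q
  rw [← map_permute_iid q σ] at h
  filter_upwards [hRq q, ae_of_ae_map (measurable_permute X σ).aemeasurable h] with x h1 h2
  rw [h1, h2]

/-- This makes de Finetti's theorem available for weighted measures, which is why that theorem is
stated for finite rather than probability measures. -/
theorem swapInvariant_withDensity {p : Measure (ℕ → X)} (hp : SwapInvariant p)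
    {φ : (ℕ → X) → ENNReal} (hφ : Measurable φ)
    (h : ∀ i j, ∀ᵐ x ∂p, φ (permute X (Equiv.swap i j) x) = φ x) :
    SwapInvariant (p.withDensity φ) := fun i j => by
  have hm := measurable_permute X (Equiv.swap i j)
  ext S hS
  rw [Measure.map_apply hm hS, withDensity_apply _ (hm hS), withDensity_apply _ hS]
  conv_rhs => rw [← hp i j, setLIntegral_map hS hφ hm]
  exact setLIntegral_congr_fun_ae (hm hS) ((h i j).mono fun x hx _ => hx.symm)

include hR in
/-- Almost surely invariant functions are almost surely functions of the directing measure. -/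
theorem setLIntegral_eq_of_invariant (hRq : ∀ q, ∀ᵐ x ∂(iid X q), R x = q)
    (hRν : ∀ (ν : Measure (ℕ → X)) [IsFiniteMeasure ν], SwapInvariant ν → iid X ∘ₘ ν.map R = ν)
    {p : Measure (ℕ → X)} [IsFiniteMeasure p] (hp : SwapInvariant p)
    {φ : (ℕ → X) → ENNReal} (hφ : Measurable φ) (hφ1 : ∀ x, φ x ≤ 1)
    (h : ∀ i j, ∀ᵐ x ∂p, φ (permute X (Equiv.swap i j) x) = φ x)
    {A : Set (ℕ → X)} (hA : MeasurableSet A) :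
    ∫⁻ x in A, ∫⁻ y, φ y ∂(iid X (R x)) ∂p = ∫⁻ x in A, φ x ∂p := by
  have hint : Measurable fun q => ∫⁻ y, φ y ∂(iid X q) := hφ.lintegral_kernel
  have hiidA : Measurable fun q => iid X q A := Kernel.measurable_coe _ hA
  have hfin : IsFiniteMeasure (p.withDensity φ) := by
    refine isFiniteMeasure_withDensity (ne_top_of_le_ne_top (measure_ne_top p Set.univ) ?_)
    exact (lintegral_mono hφ1).trans (by simp)
  have hν := hRν _ (swapInvariant_withDensity hp hφ h)
  have hpR := hRν p hp
  have hind : Measurable (A.indicator (1 : (ℕ → X) → ENNReal)) := measurable_one.indicator hA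
  -- Both ends reduce to the integral of `iid X q A * ∫ φ d(iid X q)` over the mixing measure:
  -- conditional expectation given `R` is self-adjoint. De Finetti for `p` reaches it from the left,
  -- and de Finetti for the weighted measure removes the conditioning from `A` on the right.
  calc ∫⁻ x in A, ∫⁻ y, φ y ∂(iid X (R x)) ∂p
      = ∫⁻ x, A.indicator 1 x * ∫⁻ y, φ y ∂(iid X (R x)) ∂p := by
        rw [← lintegral_indicator hA]
        refine lintegral_congr fun x => ?_
        by_cases hx : x ∈ A <;> simp [hx]
    _ = ∫⁻ q, ∫⁻ x, A.indicator 1 x * ∫⁻ y, φ y ∂(iid X q) ∂(iid X q) ∂(p.map R) := by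
        conv_lhs => rw [← hpR]
        exact lintegral_mixture hR hRq _
          (G := fun q x => A.indicator 1 x * ∫⁻ y, φ y ∂(iid X q))
          ((hind.comp measurable_snd).mul (hint.comp measurable_fst))
    _ = ∫⁻ q, ∫⁻ x, iid X q A * φ x ∂(iid X q) ∂(p.map R) := by
        refine lintegral_congr fun q => ?_
        rw [lintegral_mul_const _ hind, lintegral_const_mul _ hφ, lintegral_indicator_one hA]
    _ = ∫⁻ x, iid X (R x) A * φ x ∂p := by
        conv_rhs => rw [← hpR]
        exact (lintegral_mixture hR hRq _ (G := fun q x => iid X q A * φ x)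
          ((hiidA.comp measurable_fst).mul (hφ.comp measurable_snd))).symm
    _ = (p.withDensity φ) A := by
        conv_rhs => rw [← hν]
        rw [Measure.bind_apply hA (Kernel.aemeasurable _), lintegral_map hiidA hR,
          lintegral_withDensity_eq_lintegral_mul (g := fun x => iid X (R x) A) _ hφ
            (hiidA.comp hR)]
        exact lintegral_congr fun x => mul_comm _ _
    _ = ∫⁻ x in A, φ x ∂p := withDensity_apply _ hA

end Mixture

open PSBorel

/-! ### The limit and the invariant object -/

section Main

variable {X : Type u} [MeasurableSpace X] [StandardBorelSpace X]

theorem sampCopy_eq_homMk (p : ProbabilityMeasure (ℕ → X))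
    (μ : ProbabilityMeasure (ProbabilityMeasure X))
    (h : sampN X ∘ₘ (copyN (ProbabilityMeasure X) ∘ₘ (μ : Measure (ProbabilityMeasure X))) = p) :
    sampCopy p μ h = homMk (x := .of (ProbabilityMeasure X) μ) (y := .of (ℕ → X) p) (iid X)
      ((sampN_comp_copyN_comp _).symm.trans h) := rfl

/-- Categorical invariance is one equation per permutation, so the null set may depend on `σ`; hence
the order of the quantifiers. -/
theorem leftInvariant_homMk_iff {p : ProbabilityMeasure (ℕ → X)} (hp : Exchangeable p)
    {a : PSBorel.{u}} {k : Kernel a.carrier (ℕ → X)} [IsMarkovKernel k]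
    (hk : k ∘ₘ (a.law : Measure a.carrier) = p) :
    LeftInvariant (permSystem p hp) (homMk (y := .of (ℕ → X) p) k hk) ↔
      ∀ σ ∈ FinPerm, ∀ᵐ y ∂(a.law : Measure a.carrier), (k y).map (permute X σ) = k y := by
  have key (σ : Equiv.Perm ℕ) (hσ : σ ∈ FinPerm) :
      homMk (y := .of (ℕ → X) p) k hk ≫
          homMk (x := .of (ℕ → X) p) (y := .of (ℕ → X) p) (permKernel X σ) (hp σ hσ)
        = homMk (y := .of (ℕ → X) p) k hk ↔
      ∀ᵐ y ∂(a.law : Measure a.carrier), (k y).map (permute X σ) = k y := by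
    rw [homMk_comp, homMk_eq_iff_ae]
    refine eventually_congr (Eventually.of_forall fun y => ?_)
    rw [Kernel.comp_apply]
    change permKernel X σ ∘ₘ k y = k y ↔ _
    rw [permKernel, Measure.deterministic_comp_eq_map]
  exact ⟨fun h σ hσ => (key σ hσ).1 (h ⟨σ, hσ⟩), fun h σ => (key σ.1 σ.2).2 (h σ.1 σ.2)⟩

theorem rightInvariant_homMk_iff {p : ProbabilityMeasure (ℕ → X)} (hp : Exchangeable p)
    {b : PSBorel.{u}} {k : Kernel (ℕ → X) b.carrier} [IsMarkovKernel k]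
    (hk : k ∘ₘ (p : Measure (ℕ → X)) = b.law) :
    RightInvariant (permSystem p hp) (homMk (x := .of (ℕ → X) p) k hk) ↔
      ∀ σ ∈ FinPerm, ∀ᵐ x ∂(p : Measure (ℕ → X)), k (permute X σ x) = k x := by
  have key (σ : Equiv.Perm ℕ) (hσ : σ ∈ FinPerm) :
      homMk (x := .of (ℕ → X) p) (y := .of (ℕ → X) p) (permKernel X σ) (hp σ hσ) ≫
          homMk (x := .of (ℕ → X) p) k hk
        = homMk (x := .of (ℕ → X) p) k hk ↔
      ∀ᵐ x ∂(p : Measure (ℕ → X)), k (permute X σ x) = k x := by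
    rw [homMk_comp, homMk_eq_iff_ae]
    refine eventually_congr (Eventually.of_forall fun x => ?_)
    change (k ∘ₖ permKernel X σ) x = k x ↔ _
    rw [permKernel, Kernel.comp_deterministic_eq_comap, Kernel.comap_apply]
  exact ⟨fun h σ hσ => (key σ hσ).1 (h ⟨σ, hσ⟩), fun h σ => (key σ.1 σ.2).2 (h σ.1 σ.2)⟩

/-- Let `R` be a directing map that recovers the marginals of iid sequences. Then the mixture map
`iid` and `R` form a split idempotent on `(X^ℕ, p)` which exhibits `(PX, μ)` as the limit and the
invariant object of the system. -/
theorem isLimitingCone_and_isInvariantObject {R : (ℕ → X) → ProbabilityMeasure X}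
    (hR : Measurable R) (hRq : ∀ q, ∀ᵐ x ∂(iid X q), R x = q)
    (hRν : ∀ (ν : Measure (ℕ → X)) [IsFiniteMeasure ν], SwapInvariant ν → iid X ∘ₘ ν.map R = ν)
    {p : ProbabilityMeasure (ℕ → X)} (hp : Exchangeable p)
    {μ : ProbabilityMeasure (ProbabilityMeasure X)}
    (hμ : iid X ∘ₘ (μ : Measure (ProbabilityMeasure X)) = p)
    (hdet : Kernel.deterministic R hR ∘ₘ (p : Measure (ℕ → X)) = μ)
    {ℓ : of (ProbabilityMeasure X) μ ⟶ of (ℕ → X) p}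
    (hℓ : ℓ = homMk (x := of (ProbabilityMeasure X) μ) (y := of (ℕ → X) p) (iid X) hμ)
    {r : of (ℕ → X) p ⟶ of (ProbabilityMeasure X) μ}
    (hr : r = homMk (x := of (ℕ → X) p) (y := of (ProbabilityMeasure X) μ)
      (Kernel.deterministic R hR) hdet) :
    IsLimitingCone (permSystem p hp) ℓ ∧ IsInvariantObject (permSystem p hp) r := by
  have hℓr : ℓ ≫ r = 𝟙 _ := by
    rw [hℓ, hr, homMk_comp, id_eq_homMk, homMk_eq_iff_ae]
    exact Eventually.of_forall fun q =>
      congrFun (congrArg DFunLike.coe (deterministic_comp_iid hR hRq)) q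
  have hℓinv : LeftInvariant (permSystem p hp) ℓ := by
    rw [hℓ]
    exact (leftInvariant_homMk_iff (a := of (ProbabilityMeasure X) μ) hp hμ).2
      fun σ _ => Eventually.of_forall fun q => map_permute_iid q σ
  have hfix (b : PSBorel.{u}) (f : of (ℕ → X) p ⟶ b)
      (hf : RightInvariant (permSystem p hp) f) : r ≫ ℓ ≫ f = f := by
    obtain ⟨k, _, hk, rfl⟩ := exists_homMk f
    have hkinv := (rightInvariant_homMk_iff hp hk).1 hf
    rw [hr, hℓ, homMk_comp, homMk_comp, homMk_eq_iff]
    intro A B hA hB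
    -- For fixed `B`, the function `x ↦ k x B` is an almost surely invariant density bounded by one.
    have h := setLIntegral_eq_of_invariant hR hRq hRν hp.swapInvariant
      (Kernel.measurable_coe k hB) (fun _ => prob_le_one)
      (fun i j => (hkinv _ (swap_mem_finPerm i j)).mono fun x hx => by rw [hx]) hA
    refine Eq.trans (lintegral_congr fun x => ?_) h
    rw [Kernel.comp_deterministic_eq_comap, Kernel.comap_apply, Kernel.comp_apply' _ _ _ hB]
  have hrinv : RightInvariant (permSystem p hp) r := by
    rw [hr]
    refine (rightInvariant_homMk_iff (b := of (ProbabilityMeasure X) μ) hp hdet).2 fun σ _ => ?_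
    have h := ae_directing_permute hR hRq μ σ
    rw [hμ] at h
    filter_upwards [h] with x hx
    rw [Kernel.deterministic_apply, Kernel.deterministic_apply, hx]
  have hfix' (a : PSBorel.{u}) (h : a ⟶ of (ℕ → X) p)
      (hh : LeftInvariant (permSystem p hp) h) : h ≫ r ≫ ℓ = h := by
    obtain ⟨k, _, hk, rfl⟩ := exists_homMk h
    have hkinv := (leftInvariant_homMk_iff hp hk).1 hh
    rw [hr, hℓ, homMk_comp, homMk_comp, homMk_eq_iff_ae]
    -- There are only countably many transpositions, so almost every `k y` is invariant under all of
    -- them at once. De Finetti with the common `R` then applies to each such `k y`.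
    have hall : ∀ᵐ y ∂(a.law : Measure a.carrier), SwapInvariant (k y) :=
      ae_all_iff.2 fun i => ae_all_iff.2 fun j => hkinv _ (swap_mem_finPerm i j)
    filter_upwards [hall] with y hy
    rw [Kernel.comp_apply, ← Measure.comp_assoc, Measure.deterministic_comp_eq_map]
    exact hRν _ hy
  refine ⟨isLimitingCone_of_split hℓinv hℓr hfix',
    hrinv, isColimitCoconeOfSplit hrinv hℓr hfix, fun z f hf => ?_⟩
  have h : r ≫ ℓ ≫ f = f := hfix z f hf
  -- The induced morphism is `ℓ ≫ f`, and `f` is its precomposition with the deterministic `r`.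
  have h' := isASDeterministic_comp_iff (x := of (ℕ → X) p) (y := of (ProbabilityMeasure X) μ)
    hR hdet (ℓ ≫ f)
  rw [← hr, h] at h'
  exact h'

end Main

end ASDeFinetti

theorem mainTheorem8 {X : Type u} [MeasurableSpace X] [StandardBorelSpace X]
    (p : ProbabilityMeasure (ℕ → X)) (hp : Exchangeable p) :
    (∃! μ : ProbabilityMeasure (ProbabilityMeasure X),
      sampN X ∘ₘ (copyN (ProbabilityMeasure X) ∘ₘ (μ : Measure (ProbabilityMeasure X))) = p) ∧
    ∀ (μ : ProbabilityMeasure (ProbabilityMeasure X))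
      (hμ : sampN X ∘ₘ (copyN (ProbabilityMeasure X) ∘ₘ (μ : Measure (ProbabilityMeasure X))) = p),
      PSBorel.IsLimitingCone (permSystem p hp) (sampCopy p μ hμ) ∧
      ∃ r : PSBorel.of (ℕ → X) p ⟶ PSBorel.of (ProbabilityMeasure X) μ,
        PSBorel.IsInvariantObject (permSystem p hp) r ∧
        PSBorel.IsBayesianInverse r (sampCopy p μ hμ) := by
  have : Nonempty X := (nonempty_of_isProbabilityMeasure (p : Measure (ℕ → X))).map fun x => x 0
  obtain ⟨R, hR, hRq, hRν⟩ := exists_directing_measure X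
  have hid := deterministic_comp_iid hR hRq
  -- This gives uniqueness: any mixing measure of `p` must be the image of `p` under the fixed map
  -- `R`.
  have hmap (μ : Measure (ProbabilityMeasure X)) (h : iid X ∘ₘ μ = p) :
      (p : Measure (ℕ → X)).map R = μ := by
    rw [← h, ← Measure.deterministic_comp_eq_map hR, Measure.comp_assoc, hid, Measure.id_comp]
  refine ⟨⟨pushforward R hR p, (sampN_comp_copyN_comp _).trans (hRν _ hp.swapInvariant),
    fun μ hμ => Subtype.ext (hmap μ ((sampN_comp_copyN_comp _).symm.trans hμ)).symm⟩,
    fun μ hμ => ?_⟩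
  have hμ' : iid X ∘ₘ (μ : Measure (ProbabilityMeasure X)) = p :=
    (sampN_comp_copyN_comp _).symm.trans hμ
  have hdet : Kernel.deterministic R hR ∘ₘ (p : Measure (ℕ → X)) = μ := by
    rw [Measure.deterministic_comp_eq_map, hmap μ hμ']
  obtain ⟨h1, h2⟩ := isLimitingCone_and_isInvariantObject hR hRq hRν hp hμ' hdet
    (sampCopy_eq_homMk p μ hμ) rfl
  refine ⟨h1, _, h2, ?_⟩
  have h := compProd_iid hR hRq (μ : Measure (ProbabilityMeasure X))
  rw [hμ'] at h
  exact h
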